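/- Let $0<\beta<1/2$, $0\le\theta\le1$, and let $K:(0,1)\to\mathbb R$ be measurable with $0<K_m\le K(x)\le K_M<\infty$ for almost every $x\in(0,1)$. For $\sigma>0$ put $${}_0^lI_x^{\sigma}w(x)=\frac1{\Gamma(\sigma)}\int_0^x\frac{w(s)}{(x-s)^{1-\sigma}}\,ds,\qquad {}_x^rI_1^{\sigma}w(x)=\frac1{\Gamma(\sigma)}\int_x^1\frac{w(s)}{(s-x)^{1-\sigma}}\,ds,\qquad I^\beta_\theta w=\theta\,{}_0^lI_x^\beta w+(1-\theta)\,{}_x^rI_1^\beta w,$$ and write ${}_0^rI_1^\beta u$ for the value of ${}_x^rI_1^\beta u$ at $x=0$ and ${}_0^lI_1^\beta u$ for the value of ${}_0^lI_x^\beta u$ at $x=1$. Let $H^{\mu}_0(0,1)$ be the completion of $C_c^\infty(0,1)$ in the norm $(\|w\|_{L^2(\mathbb R)}^2+\||\omega|^\mu\mathcal F w\|_{L^2(\mathbb R)}^2)^{1/2}$ of $H^\mu(\mathbb R)$, let $H^{-1}(0,1)$ be the dual space of $H^1_0(0,1)$, and let $D$ be the weak derivative. Let $f\in H^{-1}(0,1)$,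 and let $w_l,w_r,w_f\in H^1(0,1)\subset C[0,1]$ be the weak solutions of $$(KDw_l,Dv)_{L^2(0,1)}=0\quad\forall v\in H^1_0(0,1),\qquad w_l(0)=1,\ w_l(1)=0,$$ $$(KDw_r,Dv)_{L^2(0,1)}=0\quad\forall v\in H^1_0(0,1),\qquad w_r(0)=0,\ w_r(1)=1,$$ $$(KDw_f,Dv)_{L^2(0,1)}=\langle f,v\rangle\quad\forall v\in H^1_0(0,1),\qquad w_f(0)=w_f(1)=0.$$ Then $I^\beta_\theta u\in H^1(0,1)$ for every $u\in H^{1-\beta}_0(0,1)$, and a function $u$ is a weak solution of the Petrov–Galerkin problem, that is, $u\in H^{1-\beta}_0(0,1)$ and $$\bigl(KDI^\beta_\theta u,Dv\bigr)_{L^2(0,1)}=\langle f,v\rangle\qquad\forall v\in H^1_0(0,1),$$ if and only if $u\in H^{1-\beta}_0(0,1)$ and $u$ satisfies the integral equation $$I^\beta_\theta u-(1-\theta)\bigl({}_0^rI^\beta_1u\bigr)w_l-\theta\bigl({}_0^lI^\beta_1u\bigr)w_r=w_f\qquad\text{on }[0,1].$$ -/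

import Mathlib

open MeasureTheory Set Filter Topology
open scoped ENNReal Distributions FourierTransform

noncomputable section

namespace FracDiff

/-- The open interval `(0,1)`. -/
def unitInterval01 : TopologicalSpace.Opens ℝ := ⟨Ioo 0 1, isOpen_Ioo⟩

/-- Lebesgue measure on `(0,1)`. -/
def mu01 : Measure ℝ := volume.restrict (Ioo 0 1)

/-- Left fractional integral of order `σ` with base point `a`. -/
def leftFracInt (a σ : ℝ) (w : ℝ → ℝ) (x : ℝ) : ℝ :=
  (1 / Real.Gamma σ) * ∫ s in a..x, w s / (x - s) ^ (1 - σ)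

/-- Right fractional integral of order `σ` with end point `b`. -/
def rightFracInt (b σ : ℝ) (w : ℝ → ℝ) (x : ℝ) : ℝ :=
  (1 / Real.Gamma σ) * ∫ s in x..b, w s / (s - x) ^ (1 - σ)

/-- The two-sided fractional integral on `(0,1)`: `θ` times the left integral plus
`1 - θ` times the right integral. -/
def twoSidedFracInt (β θ : ℝ) (w : ℝ → ℝ) (x : ℝ) : ℝ :=
  θ * leftFracInt 0 β w x + (1 - θ) * rightFracInt 1 β w x

/-- The norm of `H^μ(ℝ)` of a real function (meant for smooth compactly supported functions):
the square root of `‖φ‖²_{L²(ℝ)} + ‖|ω|^μ 𝓕φ‖²_{L²(ℝ)}`. The Fourier transform is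
normalised with `exp (-2πiωx)`; other normalisations give equivalent norms. -/
def sobolevNorm (μ : ℝ) (φ : ℝ → ℝ) : ℝ≥0∞ :=
  (eLpNorm φ 2 volume ^ 2 +
    eLpNorm (fun ω : ℝ => ((|ω| ^ μ : ℝ) : ℂ) * 𝓕 (fun x : ℝ => (φ x : ℂ)) ω) 2 volume ^ 2)
      ^ (1 / 2 : ℝ)

/-- `u ∈ H^μ_0(0,1)`, the completion of `C_c^∞(0,1)` in the norm of `H^μ(ℝ)`, realised as a
space of functions in `L²(0,1)`: `u` is the `L²(0,1)`-limit of test functions that form a Cauchy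
sequence in the norm of `H^μ(ℝ)`. Only the values of `u` almost everywhere in `(0,1)` matter. -/
def MemHZero (μ : ℝ) (u : ℝ → ℝ) : Prop :=
  MemLp u 2 mu01 ∧
  ∃ φ : ℕ → 𝓓(unitInterval01, ℝ),
    (∀ ε : ℝ≥0∞, 0 < ε → ∃ N : ℕ, ∀ m ≥ N, ∀ n ≥ N,
      sobolevNorm μ (fun x => φ m x - φ n x) < ε) ∧
    Tendsto (fun n => eLpNorm (fun x => φ n x - u x) 2 mu01) atTop (𝓝 0)

/-- `w ∈ H¹(0,1)` with weak derivative `g`: both are in `L²(0,1)` and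
`∫ w φ' = - ∫ g φ` for every test function `φ ∈ C_c^∞(0,1)`. -/
structure HasL2WeakDeriv (w g : ℝ → ℝ) : Prop where
  memLp : MemLp w 2 mu01
  memLp_deriv : MemLp g 2 mu01
  integral_eq : ∀ φ : 𝓓(unitInterval01, ℝ),
    ∫ x, w x * deriv φ x ∂mu01 = - ∫ x, g x * φ x ∂mu01

/-- The Sobolev space `H¹(0,1)`. -/
def MemH1 (w : ℝ → ℝ) : Prop := ∃ g : ℝ → ℝ, HasL2WeakDeriv w g

/-- `L²(0,1) × L²(0,1)` with the Hilbert norm `(‖p‖² + ‖q‖²)^{1/2}`. -/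
abbrev L2Pair : Type := WithLp 2 (Lp ℝ 2 mu01 × Lp ℝ 2 mu01)

/-- The pairs `(φ, φ')`, `φ ∈ C_c^∞(0,1)`. -/
def testGraph : Submodule ℝ L2Pair where
  carrier := {p | ∃ φ : 𝓓(unitInterval01, ℝ), p.fst =ᵐ[mu01] φ ∧ p.snd =ᵐ[mu01] deriv φ}
  zero_mem' := by
    refine ⟨0, ?_, ?_⟩
    · exact Lp.coeFn_zero ℝ 2 mu01
    · refine (Lp.coeFn_zero ℝ 2 mu01).trans (Eventually.of_forall fun x => ?_)
      have : ((0 : 𝓓(unitInterval01, ℝ)) : ℝ → ℝ) = fun _ => 0 := rfl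
      simp [this]
  add_mem' := by
    rintro p q ⟨φ, hφ, hφ'⟩ ⟨ψ, hψ, hψ'⟩
    refine ⟨φ + ψ, ?_, ?_⟩
    · filter_upwards [Lp.coeFn_add p.fst q.fst, hφ, hψ] with x h1 h2 h3
      change (p.fst + q.fst : Lp ℝ 2 mu01) x = φ x + ψ x
      rw [h1, Pi.add_apply, h2, h3]
    · filter_upwards [Lp.coeFn_add p.snd q.snd, hφ', hψ'] with x h1 h2 h3
      change (p.snd + q.snd : Lp ℝ 2 mu01) x = deriv ((φ : ℝ → ℝ) + (ψ : ℝ → ℝ)) x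
      rw [h1, Pi.add_apply, h2, h3, deriv_add]
      · exact (φ.contDiff.differentiable (by simp)) x
      · exact (ψ.contDiff.differentiable (by simp)) x
  smul_mem' := by
    rintro c p ⟨φ, hφ, hφ'⟩
    refine ⟨c • φ, ?_, ?_⟩
    · filter_upwards [Lp.coeFn_smul c p.fst, hφ] with x h1 h2
      change (c • p.fst : Lp ℝ 2 mu01) x = c • φ x
      rw [h1, Pi.smul_apply, h2]
    · filter_upwards [Lp.coeFn_smul c p.snd, hφ'] with x h1 h2
      change (c • p.snd : Lp ℝ 2 mu01) x = deriv (c • (φ : ℝ → ℝ)) x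
      rw [h1, Pi.smul_apply, h2, deriv_const_smul]
      exact (φ.contDiff.differentiable (by simp)) x

/-- The Hilbert space `H¹_0(0,1)`: the completion of `C_c^∞(0,1)` in the norm
`(‖v‖² + ‖Dv‖²)^{1/2}`. An element `v` is stored as the pair `(v, Dv)`. -/
def H10 : Submodule ℝ L2Pair := testGraph.topologicalClosure

/-- The weak derivative `Dv ∈ L²(0,1)` of `v ∈ H¹_0(0,1)`. -/
def H10.D (v : H10) : Lp ℝ 2 mu01 := v.1.snd

/-- The dual space `H⁻¹(0,1)` of `H¹_0(0,1)`. -/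
abbrev HMinus1 : Type := H10 →L[ℝ] ℝ

/-- `w ∈ H¹(0,1)`, given by its continuous representative on `[0,1]`, is the weak solution of
`-D(K Dw) = f` in `(0,1)`, `w(0) = a`, `w(1) = b`:
`(K Dw, Dv)_{L²(0,1)} = ⟨f, v⟩` for all `v ∈ H¹_0(0,1)`. -/
def IsDiffusionSolution (K : ℝ → ℝ) (f : HMinus1) (a b : ℝ) (w : ℝ → ℝ) : Prop :=
  ContinuousOn w (Icc 0 1) ∧ w 0 = a ∧ w 1 = b ∧
  ∃ g : ℝ → ℝ, HasL2WeakDeriv w g ∧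
    ∀ v : H10, ∫ x, K x * g x * H10.D v x ∂mu01 = f v

/-- `u` is a weak solution of the Petrov-Galerkin formulation: `u ∈ H^{1-β}_0(0,1)` and
`(K D I^β_θ u, Dv)_{L²(0,1)} = ⟨f, v⟩` for all `v ∈ H¹_0(0,1)`, where `D I^β_θ u` is the
weak derivative in `L²(0,1)`. -/
def IsPetrovGalerkinSolution (β θ : ℝ) (K : ℝ → ℝ) (f : HMinus1) (u : ℝ → ℝ) : Prop :=
  MemHZero (1 - β) u ∧
  ∃ g : ℝ → ℝ, HasL2WeakDeriv (twoSidedFracInt β θ u) g ∧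
    ∀ v : H10, ∫ x, K x * g x * H10.D v x ∂mu01 = f v

end FracDiff

end

open scoped SchwartzMap

namespace FracDiff

/-! The equivalence is uniqueness for a Dirichlet problem plus linearity. At `x = 0` the left
integral vanishes and at `x = 1` the right one does, so `I u` has boundary values `(1 - θ) (right
integral at 0)` and `θ (left integral at 1)`. If `u` is a weak solution, `I u` minus the combination
of `wl`, `wr`, `wf` with these coefficients solves the homogeneous problem with zero boundary
values. Its flux `K h` is a constant `c` by du Bois-Reymond, and `0 = c ∫ 1/K` forces `c = 0`
(`eq_zero_of_homogeneous_diffusion`). Conversely, the integral equation exhibits `I u` as such a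
combination, and its weak derivative can be read off.

The analytic content is that `I u` is continuous on `[0,1]` and lies in `H¹(0,1)`
(`MemHZero.continuousOn_and_memH1`). On `[0,1]` the operator is convolution with an integrable
truncated kernel whose Fourier transform is `O(|ω|^{-β})` (`norm_fourier_fracKernel_le`). This decay
turns the factor `|ω|` of a derivative into `|ω|^{1-β}`, so `ψ ↦ ∫ (k * φ) ψ'` is bounded by the
`H^{1-β}` norm of `φ` times the `L²` norm of `ψ`. Since `1 - β > 1/2`, the approximating test
functions converge uniformly (`exists_bcf_limit`). The bound therefore passes to the limit, and
Hahn-Banach with Riesz produces the weak derivative (`memH1_of_bound`). -/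

instance : IsProbabilityMeasure mu01 := ⟨by simp [mu01]⟩

theorem integral_mu01_eq_intervalIntegral (h : ℝ → ℝ) :
    ∫ x, h x ∂mu01 = ∫ x in (0 : ℝ)..1, h x := by
  rw [mu01, intervalIntegral.integral_of_le zero_le_one, integral_Ioc_eq_integral_Ioo]

theorem memLp_mu01_of_continuousOn {w : ℝ → ℝ} (hw : ContinuousOn w (Icc 0 1)) (p : ℝ≥0∞) :
    MemLp w p mu01 := by
  obtain ⟨C, hC⟩ := isCompact_Icc.exists_bound_of_continuousOn hw
  refine MemLp.of_bound ((hw.mono Ioo_subset_Icc_self).aestronglyMeasurable measurableSet_Ioo) C ?_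
  exact (ae_restrict_mem measurableSet_Ioo).mono fun x hx => hC x (Ioo_subset_Icc_self hx)

theorem intervalIntegrable_of_integrable {h : ℝ → ℝ} (hh : Integrable h mu01) {a b : ℝ}
    (ha : a ∈ Icc (0 : ℝ) 1) (hb : b ∈ Icc (0 : ℝ) 1) : IntervalIntegrable h volume a b := by
  have h1 : IntervalIntegrable h volume 0 1 := by
    rw [intervalIntegrable_iff_integrableOn_Ioo_of_le zero_le_one]; exact hh
  refine h1.mono_set ?_
  rw [uIcc_of_le zero_le_one]
  exact uIcc_subset_Icc ha hb

/-! ### Test functions on the unit interval -/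

namespace TestFn

theorem eq_zero_of_notMem (φ : 𝓓(unitInterval01, ℝ)) {x : ℝ} (hx : x ∉ Ioo (0 : ℝ) 1) :
    φ x = 0 :=
  image_eq_zero_of_notMem_tsupport fun h => hx (φ.tsupport_subset h)

theorem memLp (φ : 𝓓(unitInterval01, ℝ)) (p : ℝ≥0∞) : MemLp φ p mu01 :=
  memLp_mu01_of_continuousOn φ.continuous.continuousOn p

theorem continuous_deriv (φ : 𝓓(unitInterval01, ℝ)) : Continuous (deriv φ) :=
  φ.contDiff.continuous_deriv (by simp)

theorem memLp_deriv (φ : 𝓓(unitInterval01, ℝ)) (p : ℝ≥0∞) : MemLp (deriv φ) p mu01 :=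
  memLp_mu01_of_continuousOn (continuous_deriv φ).continuousOn p

/-- The support of a test function lies in a compact subinterval of `(0,1)`. -/
theorem exists_Icc (φ : 𝓓(unitInterval01, ℝ)) :
    ∃ a b : ℝ, 0 < a ∧ a ≤ b ∧ b < 1 ∧ ∀ x ∉ Icc a b, φ x = 0 := by
  rcases (tsupport φ).eq_empty_or_nonempty with he | hne
  · refine ⟨1 / 2, 1 / 2, by norm_num, le_rfl, by norm_num, fun x _ => ?_⟩
    exact image_eq_zero_of_notMem_tsupport (by rw [he]; exact notMem_empty x)
  · have hc : IsCompact (tsupport φ) := φ.hasCompactSupport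
    obtain ⟨a, ha, ha'⟩ := hc.exists_isLeast hne
    obtain ⟨b, hb, hb'⟩ := hc.exists_isGreatest hne
    refine ⟨a, b, (φ.tsupport_subset ha).1, ha' hb, (φ.tsupport_subset hb).2, fun x hx => ?_⟩
    exact image_eq_zero_of_notMem_tsupport fun h => hx ⟨ha' h, hb' h⟩

/-- A test function with mean zero has a primitive that is a test function. -/
theorem exists_primitive (φ : 𝓓(unitInterval01, ℝ)) (h0 : ∫ x in (0 : ℝ)..1, φ x = 0) :
    ∃ ψ : 𝓓(unitInterval01, ℝ), ∀ x, deriv ψ x = φ x := by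
  obtain ⟨a, b, ha, hab, hb, hφ⟩ := exists_Icc φ
  have hd : ∀ x, HasDerivAt (fun x => ∫ s in (0 : ℝ)..x, φ s) (φ x) x := fun x =>
    intervalIntegral.integral_hasDerivAt_right (φ.continuous.intervalIntegrable _ _)
      (φ.continuous.stronglyMeasurableAtFilter _ _) φ.continuous.continuousAt
  have hz : ∀ x ∉ Icc a b, ∫ s in (0 : ℝ)..x, φ s = 0 := by
    intro x hx
    rcases not_and_or.1 hx with h | h
    · refine (intervalIntegral.integral_congr fun s hs => ?_).trans
        intervalIntegral.integral_zero
      refine hφ s fun hs' => ?_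
      have : s ≤ max 0 x := hs.2
      rcases le_max_iff.1 this with h1 | h1 <;> linarith [hs'.1]
    -- To the right of the support, the mean-zero condition removes `∫₀¹`; only the integral between
    -- `1` and `x` remains, and it avoids the support.
    · rw [← intervalIntegral.integral_add_adjacent_intervals (b := 1)
        (φ.continuous.intervalIntegrable _ _) (φ.continuous.intervalIntegrable _ _), h0, zero_add]
      refine (intervalIntegral.integral_congr fun s hs => ?_).trans
        intervalIntegral.integral_zero
      refine hφ s fun hs' => ?_
      have : min 1 x ≤ s := hs.1
      rcases min_le_iff.1 this with h1 | h1 <;> linarith [hs'.2]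
  have hts : tsupport (fun x => ∫ s in (0 : ℝ)..x, φ s) ⊆ Icc a b := by
    refine closure_minimal (fun x hx => ?_) isClosed_Icc
    by_contra h
    exact hx (hz x h)
  have hderiv : deriv (fun x => ∫ s in (0 : ℝ)..x, φ s) = φ := funext fun x => (hd x).deriv
  refine ⟨⟨fun x => ∫ s in (0 : ℝ)..x, φ s, ?_, ?_, ?_⟩, fun x => (hd x).deriv⟩
  · rw [contDiff_infty_iff_deriv, hderiv]
    exact ⟨fun x => (hd x).differentiableAt, φ.contDiff⟩
  · exact HasCompactSupport.of_support_subset_isCompact isCompact_Icc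
      ((subset_tsupport _).trans hts)
  · exact hts.trans (Icc_subset_Ioo ha hb)

/-- There is a test function with integral one. -/
theorem exists_integral_eq_one : ∃ η : 𝓓(unitInterval01, ℝ), ∫ x in (0 : ℝ)..1, η x = 1 := by
  let B : ContDiffBump (1 / 2 : ℝ) := ⟨1 / 8, 1 / 4, by norm_num, by norm_num⟩
  have hts : tsupport (B.normed volume) ⊆ Ioo 0 1 := by
    rw [B.tsupport_normed_eq, Real.closedBall_eq_Icc]
    exact Icc_subset_Ioo (by norm_num [B]) (by norm_num [B])
  refine ⟨⟨B.normed volume, B.contDiff_normed, B.hasCompactSupport_normed, hts⟩, ?_⟩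
  refine Eq.trans ?_ (B.integral_normed (μ := volume))
  rw [intervalIntegral.integral_of_le zero_le_one, integral_Ioc_eq_integral_Ioo]
  exact setIntegral_eq_integral_of_forall_compl_eq_zero fun x hx =>
    image_eq_zero_of_notMem_tsupport fun h => hx (hts h)

end TestFn

/-! ### Weak derivatives and their continuous representatives -/

/-- The du Bois-Reymond lemma on `(0,1)`. -/
theorem ae_eq_const_of_integral_mul_deriv_eq_zero {w : ℝ → ℝ} (hw : Integrable w mu01)
    (h : ∀ φ : 𝓓(unitInterval01, ℝ), ∫ x, w x * deriv φ x ∂mu01 = 0) :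
    ∃ c : ℝ, w =ᵐ[mu01] fun _ => c := by
  obtain ⟨η, hη⟩ := TestFn.exists_integral_eq_one
  have hint : ∀ φ : 𝓓(unitInterval01, ℝ), Integrable (fun x => w x * φ x) mu01 := fun φ =>
    hw.mul_of_top_left (TestFn.memLp φ ⊤)
  set c := ∫ x, w x * η x ∂mu01 with hc
  refine ⟨c, ?_⟩
  have key : ∀ φ : 𝓓(unitInterval01, ℝ), ∫ x, φ x * (w x - c) ∂mu01 = 0 := by
    intro φ
    set m := ∫ x in (0 : ℝ)..1, φ x with hm
    -- Subtracting `m • η` makes the mean zero, so the difference is the derivative of a test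
    -- function and the hypothesis applies.
    obtain ⟨ψ, hψ⟩ := TestFn.exists_primitive (φ - m • η) (by
      change ∫ x in (0 : ℝ)..1, (φ x - m * η x) = 0
      rw [intervalIntegral.integral_sub (φ.continuous.intervalIntegrable _ _)
        ((η.continuous.const_mul m |>.intervalIntegrable _ _)),
        intervalIntegral.integral_const_mul, hη, mul_one, sub_self])
    have h1 := h ψ
    have h2 : ∀ x, w x * deriv ψ x = w x * φ x - m * (w x * η x) := fun x => by
      rw [hψ]; change w x * (φ x - m * η x) = _; ring
    simp_rw [h2] at h1
    rw [integral_sub (hint φ) ((hint η).const_mul m), integral_const_mul, ← hc] at h1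
    have h3 : ∀ x, φ x * (w x - c) = w x * φ x - φ x * c := fun x => by ring
    simp_rw [h3]
    rw [integral_sub (hint φ) (((TestFn.memLp φ 1).integrable le_rfl).mul_const c),
      integral_mul_const, integral_mu01_eq_intervalIntegral φ, ← hm, h1]
  have hae := isOpen_Ioo.ae_eq_zero_of_integral_contDiff_smul_eq_zero (μ := mu01)
    (f := fun x => w x - c) (U := Ioo 0 1)
    ((hw.sub (integrable_const c)).locallyIntegrable.locallyIntegrableOn _)
    (fun g hg hgc hgs => key ⟨g, hg, hgc, hgs⟩)
  filter_upwards [hae, ae_restrict_mem measurableSet_Ioo] with x hx hx'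
  exact sub_eq_zero.1 (hx hx')

/-- A primitive of an integrable function is absolutely continuous, so integration by parts applies;
the boundary terms die because `φ` vanishes at `0` and `1`. -/
theorem integral_primitive_mul_deriv {h : ℝ → ℝ} (hh : Integrable h mu01)
    (φ : 𝓓(unitInterval01, ℝ)) :
    ∫ x, (∫ s in (0 : ℝ)..x, h s) * deriv φ x ∂mu01 = - ∫ x, h x * φ x ∂mu01 := by
  have h1 : IntervalIntegrable h volume 0 1 :=
    intervalIntegrable_of_integrable hh (by simp) (by simp)
  have hac := h1.absolutelyContinuousOnInterval_intervalIntegral (c := 0) (by simp)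
  have hφac : AbsolutelyContinuousOnInterval φ 0 1 :=
    (φ.contDiff.of_le (by simp)).contDiffOn.absolutelyContinuousOnInterval
  have := hac.integral_mul_deriv_eq_deriv_mul hφac
  rw [integral_mu01_eq_intervalIntegral, this, TestFn.eq_zero_of_notMem φ (x := 1) (by simp),
    TestFn.eq_zero_of_notMem φ (x := 0) (by simp), integral_mu01_eq_intervalIntegral]
  simp only [mul_zero, sub_self, zero_sub, neg_inj]
  refine intervalIntegral.integral_congr_ae ?_
  filter_upwards [h1.ae_hasDerivAt_integral] with x hx hx'
  rw [(hx (uIoc_subset_uIcc hx') 0 (by simp)).deriv]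

theorem HasL2WeakDeriv.integrable_deriv {w g : ℝ → ℝ} (h : HasL2WeakDeriv w g) :
    Integrable g mu01 := h.memLp_deriv.integrable (by norm_num)

/-- The fundamental theorem of calculus for the continuous representative. -/
theorem HasL2WeakDeriv.sub_eq_integral {w g : ℝ → ℝ} (h : HasL2WeakDeriv w g)
    (hw : ContinuousOn w (Icc 0 1)) {x : ℝ} (hx : x ∈ Icc (0 : ℝ) 1) :
    w x - w 0 = ∫ s in (0 : ℝ)..x, g s := by
  have hg := h.integrable_deriv
  have hG : ContinuousOn (fun x => ∫ s in (0 : ℝ)..x, g s) (Icc 0 1) := by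
    have := ((intervalIntegrable_of_integrable hg (a := 0) (b := 1) (by simp)
      (by simp)).absolutelyContinuousOnInterval_intervalIntegral (c := 0) (by simp)).continuousOn
    rwa [uIcc_of_le zero_le_one] at this
  have hi : ∀ {v : ℝ → ℝ}, ContinuousOn v (Icc 0 1) → Integrable v mu01 := fun hv =>
    (memLp_mu01_of_continuousOn hv 1).integrable le_rfl
  obtain ⟨c, hc⟩ := ae_eq_const_of_integral_mul_deriv_eq_zero
    (w := fun x => w x - ∫ s in (0 : ℝ)..x, g s) ((hi hw).sub (hi hG)) (by
      intro φ
      simp_rw [sub_mul]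
      rw [integral_sub, h.integral_eq, integral_primitive_mul_deriv hg, sub_self]
      · exact (hi hw).mul_of_top_left (TestFn.memLp_deriv φ ⊤)
      · exact (hi hG).mul_of_top_left (TestFn.memLp_deriv φ ⊤))
  -- Continuity upgrades a.e. equality to equality on the open interval, then to the endpoints by
  -- closure.
  have heq : EqOn (fun x => w x - ∫ s in (0 : ℝ)..x, g s) (fun _ => c) (Icc 0 1) := by
    have h1 : EqOn (fun x => w x - ∫ s in (0 : ℝ)..x, g s) (fun _ => c) (Ioo 0 1) :=
      Measure.eqOn_open_of_ae_eq hc isOpen_Ioo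
        ((hw.sub hG).mono Ioo_subset_Icc_self) continuousOn_const
    have h2 := h1.of_subset_closure (hw.sub hG) continuousOn_const Ioo_subset_Icc_self
      (by rw [closure_Ioo zero_ne_one])
    exact h2
  have e0 := heq (show (0 : ℝ) ∈ Icc (0 : ℝ) 1 by simp)
  have e1 := heq hx
  simp only [intervalIntegral.integral_same, sub_zero] at e0 e1
  linarith

/-- Test functions as elements of `H¹_0(0,1)`. -/
theorem exists_H10_D_ae_eq_deriv (φ : 𝓓(unitInterval01, ℝ)) :
    ∃ v : H10, H10.D v =ᵐ[mu01] deriv φ := by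
  refine ⟨⟨WithLp.toLp 2 ((TestFn.memLp φ 2).toLp φ, (TestFn.memLp_deriv φ 2).toLp (deriv φ)), ?_⟩,
    (TestFn.memLp_deriv φ 2).coeFn_toLp⟩
  exact testGraph.le_topologicalClosure
    ⟨φ, (TestFn.memLp φ 2).coeFn_toLp, (TestFn.memLp_deriv φ 2).coeFn_toLp⟩

section Linearity

variable {w₁ w₂ g₁ g₂ : ℝ → ℝ}

theorem HasL2WeakDeriv.add (h₁ : HasL2WeakDeriv w₁ g₁) (h₂ : HasL2WeakDeriv w₂ g₂) :
    HasL2WeakDeriv (fun x => w₁ x + w₂ x) (fun x => g₁ x + g₂ x) where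
  memLp := h₁.memLp.add h₂.memLp
  memLp_deriv := h₁.memLp_deriv.add h₂.memLp_deriv
  integral_eq φ := by
    simp_rw [add_mul]
    rw [integral_add, integral_add, h₁.integral_eq, h₂.integral_eq]
    · ring
    · exact h₁.memLp_deriv.integrable_mul (TestFn.memLp φ 2)
    · exact h₂.memLp_deriv.integrable_mul (TestFn.memLp φ 2)
    · exact h₁.memLp.integrable_mul (TestFn.memLp_deriv φ 2)
    · exact h₂.memLp.integrable_mul (TestFn.memLp_deriv φ 2)

theorem HasL2WeakDeriv.const_mul (h₁ : HasL2WeakDeriv w₁ g₁) (c : ℝ) :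
    HasL2WeakDeriv (fun x => c * w₁ x) (fun x => c * g₁ x) where
  memLp := h₁.memLp.const_mul c
  memLp_deriv := h₁.memLp_deriv.const_mul c
  integral_eq φ := by
    simp_rw [mul_assoc]
    rw [integral_const_mul, integral_const_mul, h₁.integral_eq]
    ring

theorem HasL2WeakDeriv.congr (h₁ : HasL2WeakDeriv w₁ g₁) (h : ∀ x ∈ Ioo (0 : ℝ) 1, w₁ x = w₂ x) :
    HasL2WeakDeriv w₂ g₁ := by
  have hae : w₁ =ᵐ[mu01] w₂ := (ae_restrict_mem measurableSet_Ioo).mono h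
  refine ⟨(memLp_congr_ae hae).1 h₁.memLp, h₁.memLp_deriv, fun φ => ?_⟩
  rw [← h₁.integral_eq]
  exact integral_congr_ae (hae.mono fun x hx => by simp only [hx])

end Linearity

/-! ### Uniqueness for the diffusion problem -/

section Diffusion

variable {K : ℝ → ℝ} {Km KM : ℝ}

theorem memLp_coeff_mul (hKm : 0 < Km) (hK_meas : AEStronglyMeasurable K mu01)
    (hK : ∀ᵐ x ∂mu01, Km ≤ K x ∧ K x ≤ KM) {g : ℝ → ℝ} (hg : MemLp g 2 mu01) :
    MemLp (fun x => K x * g x) 2 mu01 := by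
  refine MemLp.of_le_mul (c := KM) hg (hK_meas.mul hg.1) ?_
  filter_upwards [hK] with x hx
  rw [norm_mul]
  gcongr
  rw [Real.norm_of_nonneg (hKm.le.trans hx.1)]
  exact hx.2

theorem integrable_coeff_mul (hKm : 0 < Km) (hK_meas : AEStronglyMeasurable K mu01)
    (hK : ∀ᵐ x ∂mu01, Km ≤ K x ∧ K x ≤ KM) {g : ℝ → ℝ} (hg : MemLp g 2 mu01) (v : H10) :
    Integrable (fun x => K x * g x * H10.D v x) mu01 :=
  (memLp_coeff_mul hKm hK_meas hK hg).integrable_mul (Lp.memLp _)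

/-- Uniqueness for the homogeneous Dirichlet problem. -/
theorem eq_zero_of_homogeneous_diffusion (hKm : 0 < Km) (hK_meas : AEStronglyMeasurable K mu01)
    (hK : ∀ᵐ x ∂mu01, Km ≤ K x ∧ K x ≤ KM) {z h : ℝ → ℝ} (hz : ContinuousOn z (Icc 0 1))
    (hz0 : z 0 = 0) (hz1 : z 1 = 0) (hzh : HasL2WeakDeriv z h)
    (hv : ∀ v : H10, ∫ x, K x * h x * H10.D v x ∂mu01 = 0) :
    ∀ x ∈ Icc (0 : ℝ) 1, z x = 0 := by
  -- The equation tested on `C_c^∞` says that the flux `K h` has zero weak derivative.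
  obtain ⟨c, hc⟩ := ae_eq_const_of_integral_mul_deriv_eq_zero (w := fun x => K x * h x)
    ((memLp_coeff_mul hKm hK_meas hK hzh.memLp_deriv).integrable (by norm_num)) (by
      intro φ
      obtain ⟨v, hvφ⟩ := exists_H10_D_ae_eq_deriv φ
      rw [← hv v]
      exact integral_congr_ae (hvφ.mono fun x hx => by simp only [hx]))
  have hh : h =ᵐ[mu01] fun x => c * (K x)⁻¹ := by
    filter_upwards [hc, hK] with x hx hx'
    have : K x ≠ 0 := (hKm.trans_le hx'.1).ne'
    field_simp
    linarith
  have hKinv : Integrable (fun x => (K x)⁻¹) mu01 := by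
    refine (MemLp.of_bound hK_meas.aemeasurable.inv.aestronglyMeasurable Km⁻¹ ?_ :
      MemLp _ 1 mu01).integrable le_rfl
    filter_upwards [hK] with x hx
    rw [Pi.inv_apply, norm_inv, Real.norm_of_nonneg (hKm.le.trans hx.1)]
    exact inv_anti₀ hKm hx.1
  have hpos : 0 < ∫ x, (K x)⁻¹ ∂mu01 := by
    rw [integral_pos_iff_support_of_nonneg_ae]
    · have : ∀ᵐ x ∂mu01, x ∈ Function.support fun x => (K x)⁻¹ := by
        filter_upwards [hK] with x hx
        exact inv_ne_zero (hKm.trans_le hx.1).ne'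
      have h1 : Function.support (fun x => (K x)⁻¹) =ᵐ[mu01] univ := eventuallyEq_univ.2 this
      rw [measure_congr h1]
      simp [mu01]
    · filter_upwards [hK] with x hx
      exact inv_nonneg.2 (hKm.le.trans hx.1)
    · exact hKinv
  -- The two boundary values give `0 = z 1 - z 0 = c ∫ 1/K`, with a positive integral.
  have h01 := hzh.sub_eq_integral hz (show (1 : ℝ) ∈ Icc (0 : ℝ) 1 by simp)
  rw [hz1, hz0, sub_zero, ← integral_mu01_eq_intervalIntegral, integral_congr_ae hh,
    integral_const_mul] at h01
  have hc0 : c = 0 := by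
    rcases mul_eq_zero.1 h01.symm with h | h
    · exact h
    · exact absurd h hpos.ne'
  have hh0 : ∀ᵐ x, x ∈ Ioo (0 : ℝ) 1 → h x = 0 := by
    have : ∀ᵐ x ∂mu01, h x = 0 := hh.mono fun x hx => by
      rw [hx]; simp only [hc0, zero_mul]
    exact (ae_restrict_iff' measurableSet_Ioo).1 this
  intro x hx
  have := hzh.sub_eq_integral hz hx
  rw [hz0, sub_zero] at this
  rw [this, intervalIntegral.integral_of_le hx.1, integral_Ioc_eq_integral_Ioo]
  refine setIntegral_eq_zero_of_ae_eq_zero ?_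
  filter_upwards [hh0] with s hs hs'
  exact hs ⟨hs'.1, hs'.2.trans_le hx.2⟩

end Diffusion

/-! ### Duality criterion for `H¹` -/

/-- If `φ ↦ ∫ w φ'` is bounded in the `L²` norm, then `w` has a weak derivative in `L²`. -/
theorem memH1_of_bound {w : ℝ → ℝ} (hw : MemLp w 2 mu01) (C : ℝ)
    (hC : ∀ φ : 𝓓(unitInterval01, ℝ),
      |∫ x, w x * deriv φ x ∂mu01| ≤ C * (eLpNorm φ 2 mu01).toReal) : MemH1 w := by
  let T : 𝓓(unitInterval01, ℝ) →ₗ[ℝ] Lp ℝ 2 mu01 :=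
    { toFun := fun φ => (TestFn.memLp φ 2).toLp φ
      map_add' := fun φ ψ => rfl
      map_smul' := fun c φ => rfl }
  let ℓ : 𝓓(unitInterval01, ℝ) →ₗ[ℝ] ℝ :=
    { toFun := fun φ => ∫ x, w x * deriv φ x ∂mu01
      map_add' := fun φ ψ => by
        have : ∀ x, deriv (φ + ψ : 𝓓(unitInterval01, ℝ)) x = deriv φ x + deriv ψ x := fun x =>
          deriv_add (φ.contDiff.differentiable (by simp) x) (ψ.contDiff.differentiable (by simp) x)
        simp_rw [this, mul_add]
        exact integral_add (hw.integrable_mul (TestFn.memLp_deriv φ 2))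
          (hw.integrable_mul (TestFn.memLp_deriv ψ 2))
      map_smul' := fun c φ => by
        have : ∀ x, deriv (c • φ : 𝓓(unitInterval01, ℝ)) x = c * deriv φ x := fun x =>
          deriv_const_smul c (φ.contDiff.differentiable (by simp) x)
        simp_rw [this, mul_left_comm _ c]
        exact integral_const_mul _ _ }
  have hbound : ∀ φ, |ℓ φ| ≤ C * ‖T φ‖ := fun φ => by
    rw [show ‖T φ‖ = _ from Lp.norm_toLp _ (TestFn.memLp φ 2)]
    exact hC φ
  -- The bound makes `ℓ` vanish wherever the `L²` class does, so `ℓ` descends to the range of `T` in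
  -- `L²`.
  have hker : T.ker ≤ ℓ.ker := fun φ hφ => by
    have := hbound φ
    rw [LinearMap.mem_ker.1 hφ, norm_zero, mul_zero] at this
    exact abs_nonpos_iff.1 this
  let ℓ' : T.range →ₗ[ℝ] ℝ := (T.ker.liftQ ℓ hker) ∘ₗ T.quotKerEquivRange.symm.toLinearMap
  have hℓ' : ∀ φ, ℓ' ⟨T φ, φ, rfl⟩ = ℓ φ := fun φ => by
    have : T.quotKerEquivRange.symm ⟨T φ, φ, rfl⟩ = T.ker.mkQ φ := by
      rw [LinearEquiv.symm_apply_eq]; rfl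
    simp only [ℓ', LinearMap.comp_apply, LinearEquiv.coe_coe, this]
    rfl
  let ℓc : StrongDual ℝ T.range := ℓ'.mkContinuous C (by
    rintro ⟨_, φ, rfl⟩
    rw [hℓ' φ]
    exact hbound φ)
  -- Extending by Hahn-Banach avoids proving that test functions are dense in `L²`. The Riesz
  -- representative `G` is minus the weak derivative.
  obtain ⟨L, hL, -⟩ := exists_extension_norm_eq T.range ℓc
  set G := (InnerProductSpace.toDual ℝ (Lp ℝ 2 mu01)).symm L with hG
  refine ⟨fun x => -G x, hw, (Lp.memLp G).neg, fun φ => ?_⟩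
  have h1 : L (T φ) = ∫ x, w x * deriv φ x ∂mu01 := by
    have := hL ⟨T φ, φ, rfl⟩
    rw [this]
    exact hℓ' φ
  rw [← h1, ← InnerProductSpace.toDual_symm_apply, ← hG, L2.inner_def, ← integral_neg]
  refine integral_congr_ae ?_
  filter_upwards [(TestFn.memLp φ 2).coeFn_toLp] with x hx
  have : (T φ : ℝ → ℝ) x = φ x := hx
  rw [this]
  simp [mul_comm]

/-! ### Sobolev norms of Schwartz functions -/

theorem eLpNorm_schwartz_fourier (f : 𝓢(ℝ, ℂ)) :
    eLpNorm (𝓕 f : 𝓢(ℝ, ℂ)) 2 volume = eLpNorm f 2 volume := by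
  have h := f.norm_fourier_toL2_eq
  rw [SchwartzMap.norm_toLp, SchwartzMap.norm_toLp] at h
  have h1 := ((𝓕 f : 𝓢(ℝ, ℂ)).eLpNorm_lt_top 2 volume).ne
  have h2 := (f.eLpNorm_lt_top 2 volume).ne
  exact (ENNReal.toReal_eq_toReal_iff' h1 h2).1 h

/-- The Sobolev norm of a Schwartz function. -/
noncomputable def schwartzSobolevNorm (μ : ℝ) (f : 𝓢(ℝ, ℂ)) : ℝ≥0∞ :=
  (eLpNorm f 2 volume ^ 2 +
    eLpNorm (fun ω : ℝ => ((|ω| ^ μ : ℝ) : ℂ) * (𝓕 f : 𝓢(ℝ, ℂ)) ω) 2 volume ^ 2) ^ (1 / 2 : ℝ)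

theorem ENNReal.le_sqrt_sq_add_sq (a b : ℝ≥0∞) : a ≤ (a ^ 2 + b ^ 2) ^ (1 / 2 : ℝ) := by
  have h : a = (a ^ 2) ^ (1 / 2 : ℝ) := by
    rw [← ENNReal.rpow_natCast, ← ENNReal.rpow_mul]; norm_num
  conv_lhs => rw [h]
  exact ENNReal.rpow_le_rpow le_self_add (by norm_num)

theorem eLpNorm_le_schwartzSobolevNorm (μ : ℝ) (f : 𝓢(ℝ, ℂ)) :
    eLpNorm f 2 volume ≤ schwartzSobolevNorm μ f :=
  ENNReal.le_sqrt_sq_add_sq _ _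

theorem eLpNorm_weight_fourier_le_schwartzSobolevNorm (μ : ℝ) (f : 𝓢(ℝ, ℂ)) :
    eLpNorm (fun ω : ℝ => ((|ω| ^ μ : ℝ) : ℂ) * (𝓕 f : 𝓢(ℝ, ℂ)) ω) 2 volume
      ≤ schwartzSobolevNorm μ f := by
  rw [schwartzSobolevNorm, add_comm]
  exact ENNReal.le_sqrt_sq_add_sq _ _

theorem measurable_abs_rpow (μ : ℝ) : Measurable fun ω : ℝ => ((|ω| ^ μ : ℝ) : ℂ) := by
  fun_prop

/-- For `0 ≤ μ ≤ 1` one has `|ω|^μ ≤ 1 + |ω|`, and the factor `|ω|` is absorbed by the Fourier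
transform of `f'`, again a Schwartz function. -/
theorem schwartzSobolevNorm_lt_top {μ : ℝ} (hμ0 : 0 ≤ μ) (hμ1 : μ ≤ 1) (f : 𝓢(ℝ, ℂ)) :
    schwartzSobolevNorm μ f < ⊤ := by
  have hf2 : eLpNorm f 2 volume < ⊤ := f.eLpNorm_lt_top 2 volume
  suffices h : eLpNorm (fun ω : ℝ => ((|ω| ^ μ : ℝ) : ℂ) * (𝓕 f : 𝓢(ℝ, ℂ)) ω) 2 volume < ⊤ by
    refine ENNReal.rpow_lt_top_of_nonneg (by norm_num) (ENNReal.add_lt_top.2 ⟨?_, ?_⟩).ne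
    · exact ENNReal.pow_lt_top hf2
    · exact ENNReal.pow_lt_top h
  set g : 𝓢(ℝ, ℂ) := 𝓕 (SchwartzMap.derivCLM ℂ ℂ f) with hg
  have hgω : ∀ ω : ℝ, g ω = (2 * Real.pi * Complex.I * ω) * (𝓕 f : 𝓢(ℝ, ℂ)) ω := by
    intro ω
    have h1 : (⇑(SchwartzMap.derivCLM ℂ ℂ f) : ℝ → ℂ) = deriv f :=
      funext fun x => SchwartzMap.derivCLM_apply ℂ f x
    rw [hg, SchwartzMap.fourier_coe, SchwartzMap.fourier_coe, h1,
      Real.fourier_deriv f.integrable f.differentiable]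
    · rfl
    · rw [← h1]; exact (SchwartzMap.derivCLM ℂ ℂ f).integrable
  have hdom : MemLp (fun ω : ℝ => ‖(𝓕 f : 𝓢(ℝ, ℂ)) ω‖ + ‖g ω‖) 2 volume :=
    ((𝓕 f : 𝓢(ℝ, ℂ)).memLp 2).norm.add (g.memLp 2).norm
  refine (hdom.of_le ((measurable_abs_rpow μ).aestronglyMeasurable.mul
    (𝓕 f : 𝓢(ℝ, ℂ)).continuous.aestronglyMeasurable) (Eventually.of_forall fun ω => ?_)).2
  rw [Pi.mul_apply, norm_mul, Complex.norm_real,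
    Real.norm_of_nonneg (by positivity : (0 : ℝ) ≤ |ω| ^ μ),
    Real.norm_of_nonneg (by positivity), hgω]
  have hpow : |ω| ^ μ ≤ 1 + |ω| := by
    rcases le_total |ω| 1 with h | h
    · have := Real.rpow_le_one (abs_nonneg ω) h hμ0
      linarith [abs_nonneg ω]
    · have := Real.rpow_le_rpow_of_exponent_le h hμ1
      rw [Real.rpow_one] at this
      linarith
  have hn : ‖(2 * Real.pi * Complex.I * ω : ℂ)‖ = 2 * Real.pi * |ω| := by
    simp [abs_of_pos Real.pi_pos]
  rw [norm_mul, hn]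
  have hpi : |ω| ≤ 2 * Real.pi * |ω| := by
    nlinarith [abs_nonneg ω, Real.pi_gt_three]
  calc _ ≤ (1 + 2 * Real.pi * |ω|) * ‖(𝓕 f : 𝓢(ℝ, ℂ)) ω‖ := by
        gcongr; linarith
    _ = _ := by ring

/-- Comparison with `(1 + |ω|)^(-μ)`, whose square is integrable because `2μ > 1`. The factor `2 ^
μ` comes from `1 + |ω| ≤ 2 max(1, |ω|)`. -/
theorem memLp_inv_one_add_abs_rpow {μ : ℝ} (hμ : 1 / 2 < μ) :
    MemLp (fun ω : ℝ => (1 + |ω| ^ μ)⁻¹) 2 volume := by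
  have hm1 : AEStronglyMeasurable (fun ω : ℝ => (1 + |ω|) ^ (-μ)) volume :=
    Measurable.aestronglyMeasurable (by fun_prop)
  have hm2 : AEStronglyMeasurable (fun ω : ℝ => (1 + |ω| ^ μ)⁻¹) volume :=
    Measurable.aestronglyMeasurable (by fun_prop)
  have h1 : MemLp (fun ω : ℝ => (1 + |ω|) ^ (-μ)) 2 volume := by
    rw [memLp_two_iff_integrable_sq hm1]
    have := integrable_one_add_norm (E := ℝ) (μ := volume) (r := 2 * μ) (by simp; linarith)
    refine this.congr (Eventually.of_forall fun ω => ?_)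
    simp only [Real.norm_eq_abs]
    rw [← Real.rpow_natCast, ← Real.rpow_mul (by positivity)]
    congr 1; push_cast; ring
  refine h1.of_le_mul (c := 2 ^ μ) hm2 (Eventually.of_forall fun ω => ?_)
  have h0 := abs_nonneg ω
  rw [Real.norm_of_nonneg (by positivity), Real.norm_of_nonneg (by positivity),
    Real.rpow_neg (by positivity), ← div_eq_mul_inv, inv_eq_one_div,
    div_le_div_iff₀ (by positivity) (by positivity), one_mul]
  rcases le_total |ω| 1 with h | h
  · have : (1 + |ω|) ^ μ ≤ 2 ^ μ := Real.rpow_le_rpow (by positivity) (by linarith) (by linarith)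
    have h2 : (0 : ℝ) ≤ 2 ^ μ * |ω| ^ μ := by positivity
    linarith
  · have : (1 + |ω|) ^ μ ≤ (2 * |ω|) ^ μ :=
      Real.rpow_le_rpow (by positivity) (by linarith) (by linarith)
    rw [Real.mul_rpow (by norm_num) h0] at this
    have h2 : (0 : ℝ) ≤ 2 ^ μ := by positivity
    linarith

/-- The Sobolev embedding `H^μ(ℝ) ⊆ L^∞` for `μ > 1/2`, on Schwartz functions. -/
theorem exists_enorm_le_schwartzSobolevNorm {μ : ℝ} (hμ : 1 / 2 < μ) :
    ∃ C : ℝ≥0∞, C ≠ ⊤ ∧ ∀ (f : 𝓢(ℝ, ℂ)) (x : ℝ), ‖f x‖ₑ ≤ C * schwartzSobolevNorm μ f := by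
  have hw := memLp_inv_one_add_abs_rpow hμ
  refine ⟨eLpNorm (fun ω : ℝ => (1 + |ω| ^ μ)⁻¹) 2 volume * 2,
    ENNReal.mul_ne_top hw.2.ne (by simp), fun f x => ?_⟩
  set F : 𝓢(ℝ, ℂ) := 𝓕 f with hF
  have h1 : ‖f x‖ₑ ≤ eLpNorm F 1 volume := by
    have : f = 𝓕⁻ F := (FourierPair.fourierInv_fourier_eq f).symm
    rw [this, SchwartzMap.fourierInv_coe, Real.fourierInv_eq, eLpNorm_one_eq_lintegral_enorm]
    refine (enorm_integral_le_lintegral_enorm _).trans_eq (lintegral_congr fun ω => ?_)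
    rw [enorm_eq_iff_norm_eq, Circle.norm_smul]
  have hcont : Continuous F := F.continuous
  -- Dividing and multiplying by the weight prepares Cauchy-Schwarz: `L²` weight times a factor
  -- controlled by the Sobolev norm.
  have h2 : (F : ℝ → ℂ) = (fun ω : ℝ => (1 + |ω| ^ μ)⁻¹) •
      fun ω => F ω + ((|ω| ^ μ : ℝ) : ℂ) * F ω := by
    funext ω
    have : (1 + |ω| ^ μ : ℝ) ≠ 0 := by positivity
    have h3 : (1 + ((|ω| ^ μ : ℝ) : ℂ)) ≠ 0 := by exact_mod_cast this
    simp only [Pi.smul_apply', Complex.real_smul]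
    push_cast
    field_simp
  have hm : AEStronglyMeasurable (fun ω : ℝ => ((|ω| ^ μ : ℝ) : ℂ) * F ω) volume :=
    (measurable_abs_rpow μ).aestronglyMeasurable.mul hcont.aestronglyMeasurable
  have h3 : eLpNorm F 1 volume ≤ eLpNorm (fun ω : ℝ => (1 + |ω| ^ μ)⁻¹) 2 volume *
      eLpNorm (fun ω => F ω + ((|ω| ^ μ : ℝ) : ℂ) * F ω) 2 volume := by
    conv_lhs => rw [h2]
    exact eLpNorm_smul_le_mul_eLpNorm (hcont.aestronglyMeasurable.add hm) hw.1
  refine h1.trans (h3.trans ?_)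
  rw [mul_assoc]
  gcongr
  refine (eLpNorm_add_le hcont.aestronglyMeasurable hm (by norm_num)).trans ?_
  rw [two_mul]
  gcongr
  · rw [hF, eLpNorm_schwartz_fourier]
    exact eLpNorm_le_schwartzSobolevNorm μ f
  · exact eLpNorm_weight_fourier_le_schwartzSobolevNorm μ f

open scoped Convolution in
/-- Convolution with a kernel whose Fourier transform is `O(|ω|^{-β})` maps `H^{1-β}` into `H^1`,
in weak form. -/
theorem enorm_integral_convolution_mul_deriv_le {β A : ℝ} {k : ℝ → ℂ}
    (hk : Integrable k) (hkF : ∀ ω : ℝ, ω ≠ 0 → ‖𝓕 k ω‖ ≤ A * |ω| ^ (-β)) (f g : 𝓢(ℝ, ℂ)) :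
    ‖∫ x, (k ⋆[ContinuousLinearMap.mul ℂ ℂ] f) x * deriv g x‖ₑ ≤
      ENNReal.ofReal (2 * Real.pi * A) * schwartzSobolevNorm (1 - β) f * eLpNorm g 2 volume := by
  set G : 𝓢(ℝ, ℂ) := 𝓕⁻ g with hG
  have hgG : (g : ℝ → ℂ) = 𝓕 (G : ℝ → ℂ) := by
    rw [← SchwartzMap.fourier_coe, hG, FourierTransform.fourier_fourierInv_eq]
  set H : ℝ → ℂ := fun x => (-2 * Real.pi * Complex.I * x) • G x with hH
  have hxG : Integrable (fun x : ℝ => x • G x) := by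
    refine (G.integrable_pow_mul volume 1).mono (by fun_prop) (Eventually.of_forall fun x => ?_)
    simp
  have hHint : Integrable H := by
    refine (hxG.const_mul (-2 * Real.pi * Complex.I)).congr (Eventually.of_forall fun x => ?_)
    simp only [hH, Complex.real_smul, smul_eq_mul]
    ring
  have hderiv : deriv g = 𝓕 H := by
    rw [hgG]; exact Real.deriv_fourier G.integrable hxG
  have hconv : Integrable (k ⋆[ContinuousLinearMap.mul ℂ ℂ] f) :=
    hk.integrable_convolution _ f.integrable
  -- Writing `g' = 𝓕 H` lets the Fourier transform move onto the convolution by the multiplication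
  -- formula `∫ 𝓕a · b = ∫ a · 𝓕b`, which needs only integrability.
  have hswap : ∫ x, (k ⋆[ContinuousLinearMap.mul ℂ ℂ] f) x * deriv g x =
      ∫ ω, 𝓕 k ω * (𝓕 f : 𝓢(ℝ, ℂ)) ω * H ω := by
    rw [hderiv]
    have := VectorFourier.integral_fourierIntegral_smul_eq_flip (L := innerₗ ℝ)
      Real.continuous_fourierChar continuous_inner hconv hHint
    rw [flip_innerₗ] at this
    refine this.symm.trans (integral_congr_ae (Eventually.of_forall fun ω => ?_))
    exact congrArg (· * H ω) (Real.fourier_mul_convolution_eq hk f.integrable ω)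
  rw [hswap]
  set W : ℝ → ℂ := fun ω => ((|ω| ^ (1 - β) : ℝ) : ℂ) * (𝓕 f : 𝓢(ℝ, ℂ)) ω with hW
  have hWm : AEStronglyMeasurable W volume :=
    (measurable_abs_rpow _).aestronglyMeasurable.mul (𝓕 f).continuous.aestronglyMeasurable
  have hGg : eLpNorm G 2 volume = eLpNorm g 2 volume := by
    have h := eLpNorm_schwartz_fourier G
    rw [hG, FourierTransform.fourier_fourierInv_eq] at h
    exact h.symm
  have hpt : ∀ ω : ℝ, ω ≠ 0 →
      ‖𝓕 k ω * (𝓕 f : 𝓢(ℝ, ℂ)) ω * H ω‖ ≤ 2 * Real.pi * A * ‖W ω * G ω‖ := by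
    intro ω hω
    have hω' : 0 < |ω| := abs_pos.2 hω
    have hHn : ‖H ω‖ = 2 * Real.pi * |ω| * ‖G ω‖ := by
      simp [hH, abs_of_pos Real.pi_pos]
    have hWn : ‖W ω‖ = |ω| ^ (1 - β) * ‖(𝓕 f : 𝓢(ℝ, ℂ)) ω‖ := by
      rw [hW, norm_mul, Complex.norm_real, Real.norm_of_nonneg (by positivity)]
    rw [norm_mul, norm_mul, norm_mul, hHn, hWn]
    -- The kernel decay times the factor `|ω|` from `H` is exactly the weight of `H^{1-β}`.
    have hp : |ω| ^ (1 - β) = |ω| ^ (-β) * |ω| := by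
      rw [sub_eq_neg_add, Real.rpow_add hω', Real.rpow_one]
    calc _ ≤ A * |ω| ^ (-β) * ‖(𝓕 f : 𝓢(ℝ, ℂ)) ω‖ * (2 * Real.pi * |ω| * ‖G ω‖) := by
          gcongr; exact hkF ω hω
      _ = _ := by rw [hp]; ring
  have hne : ∀ᵐ ω : ℝ, ω ≠ 0 := by simp [ae_iff]
  calc _ ≤ eLpNorm (fun ω => 𝓕 k ω * (𝓕 f : 𝓢(ℝ, ℂ)) ω * H ω) 1 volume := by
        rw [eLpNorm_one_eq_lintegral_enorm]; exact enorm_integral_le_lintegral_enorm _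
    _ ≤ ENNReal.ofReal (2 * Real.pi * A) * eLpNorm (W • ⇑G) 1 volume :=
        eLpNorm_le_mul_eLpNorm_of_ae_le_mul (hne.mono hpt) 1
    _ ≤ ENNReal.ofReal (2 * Real.pi * A) * (eLpNorm W 2 volume * eLpNorm G 2 volume) := by
        gcongr
        exact eLpNorm_smul_le_mul_eLpNorm G.continuous.aestronglyMeasurable hWm
    _ ≤ _ := by
        rw [hGg, ← mul_assoc]
        gcongr
        exact eLpNorm_weight_fourier_le_schwartzSobolevNorm _ f

/-! ### Fourier decay of the fractional kernel -/

/-- The convolution kernel `t^{β-1}` of the left fractional integral, truncated to `(0,1]`. -/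
noncomputable def fracKernel (β : ℝ) : ℝ → ℝ := (Ioc 0 1).indicator fun t => t ^ (β - 1)

theorem integrable_fracKernel {β : ℝ} (hβ : 0 < β) : Integrable (fracKernel β) := by
  rw [fracKernel, integrable_indicator_iff measurableSet_Ioc,
    ← intervalIntegrable_iff_integrableOn_Ioc_of_le zero_le_one]
  exact intervalIntegral.intervalIntegrable_rpow' (by linarith)

theorem norm_exp_mul_I (y t : ℝ) : ‖Complex.exp ((y * Complex.I) * t)‖ = 1 := by
  rw [show (y * Complex.I) * t = ((y * t : ℝ) : ℂ) * Complex.I by push_cast; ring]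
  exact Complex.norm_exp_ofReal_mul_I _

theorem norm_integral_rpow_mul_exp_le_zero {β a y : ℝ} (hβ : 0 < β) (ha : 0 ≤ a) :
    ‖∫ t in (0 : ℝ)..a, ((t ^ (β - 1) : ℝ) : ℂ) * Complex.exp ((y * Complex.I) * t)‖
      ≤ a ^ β / β := by
  refine (intervalIntegral.norm_integral_le_of_norm_le (g := fun t => t ^ (β - 1)) ha
    (Eventually.of_forall fun t ht => ?_)
    (intervalIntegral.intervalIntegrable_rpow' (by linarith))).trans_eq ?_
  · rw [norm_mul, norm_exp_mul_I, mul_one, Complex.norm_real,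
      Real.norm_of_nonneg (Real.rpow_nonneg ht.1.le _)]
  · rw [integral_rpow (Or.inl (by linarith))]
    simp [Real.zero_rpow hβ.ne']

/-- Oscillation gains `1/|y|` after integrating the exponential by parts. The boundary terms
contribute `1 + a^(β-1)` and the variation of the decreasing amplitude contributes `a^(β-1) - 1`,
which sum to `2 a^(β-1)`. -/
theorem norm_integral_rpow_mul_exp_le {β a y : ℝ} (hβ1 : β < 1) (ha : 0 < a)
    (ha1 : a ≤ 1) (hy : y ≠ 0) :
    ‖∫ t in a..1, ((t ^ (β - 1) : ℝ) : ℂ) * Complex.exp ((y * Complex.I) * t)‖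
      ≤ 2 * a ^ (β - 1) / |y| := by
  set c : ℂ := y * Complex.I with hc
  have hcn : ‖c‖ = |y| := by simp [hc]
  have hc0 : c ≠ 0 := by simp [hc, hy]
  have hy0 : 0 < |y| := abs_pos.2 hy
  have hpos : ∀ t ∈ uIcc a 1, 0 < t := fun t ht => by
    rw [uIcc_of_le ha1] at ht; exact ha.trans_le ht.1
  have hu : ∀ t ∈ uIcc a 1, HasDerivAt (fun t : ℝ => ((t ^ (β - 1) : ℝ) : ℂ))
      (((β - 1) * t ^ (β - 1 - 1) : ℝ) : ℂ) t := fun t ht =>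
    (Real.hasDerivAt_rpow_const (Or.inl (hpos t ht).ne')).ofReal_comp
  have hv : ∀ t ∈ uIcc a 1, HasDerivAt (fun t : ℝ => Complex.exp (c * t) / c)
      (Complex.exp (c * t)) t := fun t _ => by
    have h1 : HasDerivAt (fun t : ℝ => c * (t : ℂ)) c t := by
      simpa using (Complex.ofRealCLM.hasDerivAt (x := t)).const_mul c
    have h2 := h1.cexp.div_const c
    rwa [mul_div_assoc, div_self hc0, mul_one] at h2
  have hcont : ContinuousOn (fun t : ℝ => t ^ (β - 1 - 1)) (uIcc a 1) :=
    ContinuousOn.rpow_const continuousOn_id fun t ht => Or.inl (hpos t ht).ne'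
  have hu' : IntervalIntegrable (fun t : ℝ => (((β - 1) * t ^ (β - 1 - 1) : ℝ) : ℂ)) volume a 1 :=
    (Complex.continuous_ofReal.comp_continuousOn
      (continuousOn_const.mul hcont)).intervalIntegrable
  have hv' : IntervalIntegrable (fun t : ℝ => Complex.exp (c * t)) volume a 1 :=
    Continuous.intervalIntegrable (by fun_prop) _ _
  rw [intervalIntegral.integral_mul_deriv_eq_deriv_mul hu hv hu' hv']
  have hvn : ∀ t : ℝ, ‖Complex.exp (c * t) / c‖ = 1 / |y| := fun t => by
    rw [norm_div, hcn, hc, norm_exp_mul_I]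
  have hint : ‖∫ t in a..1, (((β - 1) * t ^ (β - 1 - 1) : ℝ) : ℂ) * (Complex.exp (c * t) / c)‖
      ≤ (a ^ (β - 1) - 1) / |y| := by
    refine (intervalIntegral.norm_integral_le_of_norm_le
      (g := fun t => (1 - β) / |y| * t ^ (β - 1 - 1)) ha1 (Eventually.of_forall fun t ht => ?_)
      ((continuousOn_const.mul hcont).intervalIntegrable)).trans_eq ?_
    · have : 0 ≤ t ^ (β - 1 - 1) := Real.rpow_nonneg (ha.trans ht.1).le _
      rw [norm_mul, hvn, Complex.norm_real, norm_mul, Real.norm_of_nonneg this,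
        Real.norm_of_nonpos (by linarith : β - 1 ≤ 0)]
      exact le_of_eq (by ring)
    · rw [intervalIntegral.integral_const_mul, integral_rpow
        (Or.inr ⟨by linarith, fun h => (hpos 0 h).false⟩), Real.one_rpow]
      have h1 : β - 1 - 1 + 1 = β - 1 := by ring
      have h2 : β - 1 ≠ 0 := by linarith
      rw [h1]
      field_simp
      ring
  have hap : 0 ≤ a ^ (β - 1) := Real.rpow_nonneg ha.le _
  calc _ ≤ 1 * (1 / |y|) + a ^ (β - 1) * (1 / |y|) + (a ^ (β - 1) - 1) / |y| := by
        refine (norm_sub_le _ _).trans (add_le_add ((norm_sub_le _ _).trans_eq ?_) hint)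
        rw [norm_mul, norm_mul, hvn, hvn, Complex.norm_real, Complex.norm_real,
          Real.norm_of_nonneg hap, Real.one_rpow, norm_one]
    _ = _ := by ring

/-- The Fourier transform of the truncated kernel `t^{β-1}` is `O(|ω|^{-β})`. -/
theorem norm_fourier_fracKernel_le {β : ℝ} (hβ : 0 < β) (hβ1 : β < 1) {ω : ℝ} (hω : ω ≠ 0) :
    ‖𝓕 (fun t => (fracKernel β t : ℂ)) ω‖ ≤ (1 / β + 1) * |ω| ^ (-β) := by
  have hω0 : 0 < |ω| := abs_pos.2 hω
  set y : ℝ := -2 * Real.pi * ω with hy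
  have hy0 : y ≠ 0 := by simp [hy, hω]
  have hyabs : |y| = 2 * Real.pi * |ω| := by simp [hy, abs_mul, abs_of_pos Real.pi_pos]
  set F : ℝ → ℂ := fun t => ((t ^ (β - 1) : ℝ) : ℂ) * Complex.exp ((y * Complex.I) * t) with hF
  have hform : 𝓕 (fun t => (fracKernel β t : ℂ)) ω = ∫ t in (0 : ℝ)..1, F t := by
    rw [Real.fourier_real_eq_integral_exp_smul, intervalIntegral.integral_of_le zero_le_one,
      ← integral_indicator measurableSet_Ioc]
    refine integral_congr_ae (Eventually.of_forall fun t => ?_)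
    by_cases ht : t ∈ Ioc (0 : ℝ) 1
    · simp only [fracKernel, indicator_of_mem ht, hF, smul_eq_mul, hy]
      rw [mul_comm]
      congr 2
      push_cast
      ring
    · simp [fracKernel, indicator_of_notMem ht]
  rw [hform]
  have hωp : 0 < |ω| ^ (-β) := Real.rpow_pos_of_pos hω0 _
  rcases le_total |ω| 1 with h | h
  · refine (norm_integral_rpow_mul_exp_le_zero hβ zero_le_one).trans ?_
    have h1 : 1 ≤ |ω| ^ (-β) := Real.one_le_rpow_of_pos_of_le_one_of_nonpos hω0 h (by linarith)
    have h2 : 0 < 1 / β := by positivity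
    rw [Real.one_rpow]
    nlinarith
  -- Cutting at `1/|ω|` balances the trivial estimate near the singularity with the oscillatory one
  -- beyond it: both are of size `|ω|^(-β)`.
  · have ha : 0 < |ω|⁻¹ := inv_pos.2 hω0
    have ha1 : |ω|⁻¹ ≤ 1 := inv_le_one_of_one_le₀ h
    have hFi : ∀ a b : ℝ, IntervalIntegrable F volume a b := fun a b => by
      have h1 : IntervalIntegrable (fun t : ℝ => ((t ^ (β - 1) : ℝ) : ℂ)) volume a b := by
        have h2 : IntervalIntegrable (fun t : ℝ => t ^ (β - 1)) volume a b :=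
          intervalIntegral.intervalIntegrable_rpow' (by linarith)
        exact ⟨h2.1.ofReal, h2.2.ofReal⟩
      exact h1.mul_continuousOn (Continuous.continuousOn (by fun_prop))
    rw [← intervalIntegral.integral_add_adjacent_intervals (hFi 0 |ω|⁻¹) (hFi |ω|⁻¹ 1)]
    refine (norm_add_le_of_le (norm_integral_rpow_mul_exp_le_zero hβ ha.le)
      (norm_integral_rpow_mul_exp_le hβ1 ha ha1 hy0)).trans ?_
    have h1 : |ω|⁻¹ ^ β = |ω| ^ (-β) := by
      rw [Real.inv_rpow hω0.le, Real.rpow_neg hω0.le]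
    have h2 : |ω|⁻¹ ^ (β - 1) = |ω| ^ (-β) * |ω| := by
      rw [Real.inv_rpow hω0.le, ← Real.rpow_neg hω0.le, neg_sub, sub_eq_neg_add,
        Real.rpow_add hω0, Real.rpow_one]
    rw [h1, h2, hyabs]
    have h3 : 2 * (|ω| ^ (-β) * |ω|) / (2 * Real.pi * |ω|) = |ω| ^ (-β) / Real.pi := by
      field_simp
    rw [h3, add_mul, one_mul, div_mul_eq_mul_div, one_mul]
    gcongr
    exact div_le_self hωp.le (by linarith [Real.pi_gt_three])

/-- The convolution kernel of the two-sided fractional integral on `(0,1)`. -/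
noncomputable def twoSidedKernel (β θ t : ℝ) : ℝ :=
  θ * (1 / Real.Gamma β * fracKernel β t) + (1 - θ) * (1 / Real.Gamma β * fracKernel β (-t))

theorem integrable_twoSidedKernel {β : ℝ} (hβ : 0 < β) (θ : ℝ) :
    Integrable (twoSidedKernel β θ) :=
  (((integrable_fracKernel hβ).const_mul _).const_mul _).add
    (((integrable_fracKernel hβ).comp_neg.const_mul _).const_mul _)

theorem exists_norm_fourier_twoSidedKernel_le {β : ℝ} (hβ : 0 < β) (hβ1 : β < 1) (θ : ℝ) :
    ∃ A : ℝ, ∀ ω : ℝ, ω ≠ 0 → ‖𝓕 (fun t => (twoSidedKernel β θ t : ℂ)) ω‖ ≤ A * |ω| ^ (-β) := by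
  set B := 1 / Real.Gamma β with hB
  refine ⟨|θ * B| * (1 / β + 1) + |(1 - θ) * B| * (1 / β + 1), fun ω hω => ?_⟩
  have hki : Integrable fun t => (fracKernel β t : ℂ) := (integrable_fracKernel hβ).ofReal
  have hneg : 𝓕 (fun t => (fracKernel β (-t) : ℂ)) ω = 𝓕 (fun t => (fracKernel β t : ℂ)) (-ω) := by
    rw [Real.fourier_real_eq_integral_exp_smul, Real.fourier_real_eq_integral_exp_smul,
      ← integral_neg_eq_self]
    simp
  have hsum : 𝓕 (fun t => (twoSidedKernel β θ t : ℂ)) ω =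
      ((θ * B : ℝ) : ℂ) * 𝓕 (fun t => (fracKernel β t : ℂ)) ω +
        (((1 - θ) * B : ℝ) : ℂ) * 𝓕 (fun t => (fracKernel β (-t) : ℂ)) ω := by
    simp_rw [Real.fourier_real_eq_integral_exp_smul]
    rw [← integral_const_mul, ← integral_const_mul, ← integral_add]
    · refine integral_congr_ae (Eventually.of_forall fun t => ?_)
      simp only [twoSidedKernel, smul_eq_mul, ← hB]
      push_cast
      ring
    · refine Integrable.const_mul ?_ _
      have := (Real.fourierIntegral_convergent_iff (μ := volume) ω).2 hki
      refine this.congr (Eventually.of_forall fun t => ?_)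
      simp [Circle.smul_def, Real.fourierChar_apply]
      left; congr 1; ring
    · refine Integrable.const_mul ?_ _
      have := (Real.fourierIntegral_convergent_iff (μ := volume) ω).2 hki.comp_neg
      refine this.congr (Eventually.of_forall fun t => ?_)
      simp [Circle.smul_def, Real.fourierChar_apply]
      left; congr 1; ring
  have e1 := norm_fourier_fracKernel_le hβ hβ1 hω
  have e2 := norm_fourier_fracKernel_le hβ hβ1 (neg_ne_zero.2 hω)
  rw [abs_neg] at e2
  rw [hsum, hneg]
  calc _ ≤ |θ * B| * ((1 / β + 1) * |ω| ^ (-β)) + |(1 - θ) * B| * ((1 / β + 1) * |ω| ^ (-β)) := by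
        refine norm_add_le_of_le ?_ ?_
        · rw [norm_mul, Complex.norm_real, Real.norm_eq_abs]; gcongr
        · rw [norm_mul, Complex.norm_real, Real.norm_eq_abs]; gcongr
    _ = _ := by ring

/-- With `v` supported in `(0,1)` and `x ≤ 1`, only `t = x - s` in `(0,1)` contributes, so
truncating the kernel loses nothing. -/
theorem leftFracInt_eq_integral_fracKernel {β : ℝ} {v : ℝ → ℝ}
    (hv : ∀ x ∉ Ioo (0 : ℝ) 1, v x = 0) {x : ℝ} (hx : x ∈ Icc (0 : ℝ) 1) :
    leftFracInt 0 β v x = 1 / Real.Gamma β * ∫ t, fracKernel β t * v (x - t) := by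
  rw [leftFracInt]
  congr 1
  have h1 := intervalIntegral.integral_comp_sub_left (a := 0) (b := x)
    (fun s => v s / (x - s) ^ (1 - β)) x
  rw [sub_self, sub_zero] at h1
  rw [← h1, intervalIntegral.integral_of_le hx.1, ← integral_indicator measurableSet_Ioc]
  refine integral_congr_ae (Eventually.of_forall fun t => ?_)
  by_cases ht : t ∈ Ioc 0 x
  · have ht1 : t ∈ Ioc (0 : ℝ) 1 := ⟨ht.1, ht.2.trans hx.2⟩
    simp only [fracKernel, indicator_of_mem ht, indicator_of_mem ht1, sub_sub_cancel]
    rw [← neg_sub 1 β, Real.rpow_neg ht.1.le, div_eq_mul_inv, mul_comm]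
  · simp only [indicator_of_notMem ht]
    by_cases ht1 : t ∈ Ioc (0 : ℝ) 1
    · rw [hv (x - t) fun h => ht ⟨ht1.1, by linarith [h.1]⟩, mul_zero]
    · rw [fracKernel, indicator_of_notMem ht1, zero_mul]

theorem rightFracInt_eq_integral_fracKernel {β : ℝ} {v : ℝ → ℝ}
    (hv : ∀ x ∉ Ioo (0 : ℝ) 1, v x = 0) {x : ℝ} (hx : x ∈ Icc (0 : ℝ) 1) :
    rightFracInt 1 β v x = 1 / Real.Gamma β * ∫ t, fracKernel β (-t) * v (x - t) := by
  have hrefl : rightFracInt 1 β v x = leftFracInt 0 β (fun s => v (1 - s)) (1 - x) := by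
    rw [rightFracInt, leftFracInt]
    congr 1
    have h1 := intervalIntegral.integral_comp_sub_left (a := 0) (b := 1 - x)
      (fun s => v s / (s - x) ^ (1 - β)) 1
    rw [sub_sub_cancel, sub_zero] at h1
    rw [← h1]
    refine intervalIntegral.integral_congr fun s _ => ?_
    rw [show 1 - s - x = 1 - x - s by ring]
  rw [hrefl, leftFracInt_eq_integral_fracKernel
    (fun s hs => hv _ fun h => hs ⟨by linarith [h.2], by linarith [h.1]⟩)
    ⟨by linarith [hx.2], by linarith [hx.1]⟩, ← integral_neg_eq_self]
  congr 2
  funext t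
  congr 2
  ring

theorem twoSidedFracInt_eq_integral_twoSidedKernel {β : ℝ} (hβ : 0 < β) (θ : ℝ) {v : ℝ → ℝ}
    (hv : ∀ x ∉ Ioo (0 : ℝ) 1, v x = 0) (hvc : Continuous v) {C : ℝ} (hC : ∀ x, ‖v x‖ ≤ C)
    {x : ℝ} (hx : x ∈ Icc (0 : ℝ) 1) :
    twoSidedFracInt β θ v x = ∫ t, twoSidedKernel β θ t * v (x - t) := by
  have hm : AEStronglyMeasurable (fun t => v (x - t)) volume :=
    (hvc.comp (by fun_prop)).aestronglyMeasurable
  have hb : ∀ᵐ t : ℝ, ‖v (x - t)‖ ≤ C := Eventually.of_forall fun t => hC _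
  rw [twoSidedFracInt, leftFracInt_eq_integral_fracKernel hv hx,
    rightFracInt_eq_integral_fracKernel hv hx, ← integral_const_mul, ← integral_const_mul,
    ← integral_const_mul, ← integral_const_mul, ← integral_add]
  · refine integral_congr_ae (Eventually.of_forall fun t => ?_)
    simp only [twoSidedKernel]
    ring
  · exact (((integrable_fracKernel hβ).mul_bdd hm hb).const_mul _).const_mul _
  · exact (((integrable_fracKernel hβ).comp_neg.mul_bdd hm hb).const_mul _).const_mul _

/-! ### Transfer of the estimate to real test functions -/

namespace TestFn

/-- A test function as a complex-valued Schwartz function. -/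
noncomputable def toSchwartz (φ : 𝓓(unitInterval01, ℝ)) : 𝓢(ℝ, ℂ) :=
  (φ.hasCompactSupport.comp_left Complex.ofReal_zero).toSchwartzMap
    (Complex.ofRealCLM.contDiff.comp φ.contDiff)

theorem toSchwartz_apply (φ : 𝓓(unitInterval01, ℝ)) (x : ℝ) : toSchwartz φ x = (φ x : ℂ) := rfl

theorem eLpNorm_toSchwartz (φ : 𝓓(unitInterval01, ℝ)) (p : ℝ≥0∞) :
    eLpNorm (toSchwartz φ) p volume = eLpNorm φ p volume :=
  eLpNorm_congr_norm_ae (Eventually.of_forall fun x => by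
    rw [toSchwartz_apply, Complex.norm_real])

theorem sobolevNorm_eq (μ : ℝ) (φ : 𝓓(unitInterval01, ℝ)) :
    sobolevNorm μ φ = schwartzSobolevNorm μ (toSchwartz φ) := by
  rw [sobolevNorm, schwartzSobolevNorm, eLpNorm_toSchwartz]
  rfl

theorem eLpNorm_mu01 (φ : 𝓓(unitInterval01, ℝ)) (p : ℝ≥0∞) :
    eLpNorm φ p mu01 = eLpNorm φ p volume :=
  eLpNorm_restrict_eq_of_support_subset fun x hx => by
    by_contra h
    exact hx (eq_zero_of_notMem φ h)

theorem deriv_eq_zero_of_notMem (φ : 𝓓(unitInterval01, ℝ)) {x : ℝ} (hx : x ∉ Ioo (0 : ℝ) 1) :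
    deriv φ x = 0 := by
  by_contra h
  exact hx (φ.tsupport_subset (support_deriv_subset h))

end TestFn

theorem enorm_integral_conv_test_mul_deriv_le {β A : ℝ} {k : ℝ → ℝ} (hk : Integrable k)
    (hkF : ∀ ω : ℝ, ω ≠ 0 → ‖𝓕 (fun t => (k t : ℂ)) ω‖ ≤ A * |ω| ^ (-β))
    (φ ψ : 𝓓(unitInterval01, ℝ)) :
    ‖∫ x, (∫ t, k t * φ (x - t)) * deriv ψ x ∂mu01‖ₑ ≤
      ENNReal.ofReal (2 * Real.pi * A) * sobolevNorm (1 - β) φ * eLpNorm ψ 2 mu01 := by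
  have h := enorm_integral_convolution_mul_deriv_le hk.ofReal hkF
    (TestFn.toSchwartz φ) (TestFn.toSchwartz ψ)
  rw [← TestFn.sobolevNorm_eq, TestFn.eLpNorm_toSchwartz, ← TestFn.eLpNorm_mu01] at h
  refine le_trans (le_of_eq ?_) h
  -- The convolution need not vanish outside `(0,1)`, but `ψ'` does, so the Fourier estimate on the
  -- line applies.
  have h1 : ∫ x, (∫ t, k t * φ (x - t)) * deriv ψ x ∂mu01 =
      ∫ x, (∫ t, k t * φ (x - t)) * deriv ψ x :=
    setIntegral_eq_integral_of_forall_compl_eq_zero fun x hx => by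
      rw [TestFn.deriv_eq_zero_of_notMem ψ hx, mul_zero]
  rw [h1, enorm_eq_iff_norm_eq, ← Complex.norm_real, ← integral_complex_ofReal]
  congr 2
  funext x
  have h2 : deriv (TestFn.toSchwartz ψ) x = ((deriv ψ x : ℝ) : ℂ) :=
    ((ψ.contDiff.differentiable (by simp) x).hasDerivAt.ofReal_comp).deriv
  rw [h2, Complex.ofReal_mul, ← integral_complex_ofReal]
  congr 1
  refine integral_congr_ae (Eventually.of_forall fun t => ?_)
  simp [TestFn.toSchwartz_apply]

/-! ### Uniform limits and the mapping property -/

/-- The bounded continuous function underlying a test function. -/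
noncomputable def TestFn.toBCF (φ : 𝓓(unitInterval01, ℝ)) : BoundedContinuousFunction ℝ ℝ := φ

theorem eLpNorm_sub_le_dist (f g : BoundedContinuousFunction ℝ ℝ) (p : ℝ≥0∞) :
    eLpNorm (fun x => f x - g x) p mu01 ≤ ENNReal.ofReal (dist f g) := by
  refine (eLpNorm_le_of_ae_bound (C := dist f g) (Eventually.of_forall fun x => ?_)).trans ?_
  · rw [← dist_eq_norm]
    exact BoundedContinuousFunction.dist_coe_le_dist x
  · simp

/-- Functions in `H^μ_0(0,1)`, `μ > 1/2`, are uniform limits of the approximating test functions. -/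
theorem exists_bcf_limit {μ : ℝ} (hμ : 1 / 2 < μ) {u : ℝ → ℝ} (hu : MemLp u 2 mu01)
    {φ : ℕ → 𝓓(unitInterval01, ℝ)}
    (hφ : ∀ ε : ℝ≥0∞, 0 < ε → ∃ N : ℕ, ∀ m ≥ N, ∀ n ≥ N,
      sobolevNorm μ (fun x => φ m x - φ n x) < ε)
    (hlim : Tendsto (fun n => eLpNorm (fun x => φ n x - u x) 2 mu01) atTop (𝓝 0)) :
    ∃ v : BoundedContinuousFunction ℝ ℝ, Tendsto (fun n => TestFn.toBCF (φ n)) atTop (𝓝 v) ∧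
      (∀ x ∉ Ioo (0 : ℝ) 1, v x = 0) ∧ u =ᵐ[mu01] v := by
  obtain ⟨C, hC, hCS⟩ := exists_enorm_le_schwartzSobolevNorm hμ
  have hcauchy : CauchySeq fun n => TestFn.toBCF (φ n) := by
    rw [Metric.cauchySeq_iff]
    intro ε hε
    -- `C + 1` guards against `C = 0`; `ε / 2` restores the strict inequality lost in the supremum
    -- bound.
    obtain ⟨N, hN⟩ := hφ (ENNReal.ofReal (ε / 2) / (C + 1))
      (ENNReal.div_pos (by simpa using hε) (by simp [hC]))
    refine ⟨N, fun m hm n hn => ?_⟩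
    refine lt_of_le_of_lt ?_ (half_lt_self hε)
    refine (BoundedContinuousFunction.dist_le (by positivity)).2 fun x => ?_
    have h1 := hCS (TestFn.toSchwartz (φ m - φ n)) x
    rw [← TestFn.sobolevNorm_eq] at h1
    have h2 : sobolevNorm μ (φ m - φ n : 𝓓(unitInterval01, ℝ)) ≤ _ := (hN m hm n hn).le
    have h3 : ‖φ m x - φ n x‖ₑ ≤ ENNReal.ofReal (ε / 2) := by
      calc ‖φ m x - φ n x‖ₑ = ‖TestFn.toSchwartz (φ m - φ n) x‖ₑ := by
            rw [TestFn.toSchwartz_apply, enorm_eq_iff_norm_eq, Complex.norm_real]; rfl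
        _ ≤ (C + 1) * (ENNReal.ofReal (ε / 2) / (C + 1)) :=
            h1.trans (mul_le_mul' le_self_add h2)
        _ ≤ _ := ENNReal.mul_div_le
    rw [← ofReal_norm, ENNReal.ofReal_le_ofReal_iff (by positivity)] at h3
    exact h3
  obtain ⟨v, hv⟩ := cauchySeq_tendsto_of_complete hcauchy
  refine ⟨v, hv, fun x hx => ?_, ?_⟩
  · have h1 : Tendsto (fun n => TestFn.toBCF (φ n) x) atTop (𝓝 (v x)) :=
      ((BoundedContinuousFunction.lipschitz_eval_const x).continuous.tendsto v).comp hv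
    have h2 : (fun n => TestFn.toBCF (φ n) x) = fun _ => 0 :=
      funext fun n => TestFn.eq_zero_of_notMem (φ n) hx
    rw [h2] at h1
    exact tendsto_nhds_unique h1 tendsto_const_nhds
  · have hvm : MemLp v 2 mu01 := memLp_mu01_of_continuousOn v.continuous.continuousOn 2
    have h0 : eLpNorm (fun x => u x - v x) 2 mu01 = 0 := by
      have hd : Tendsto (fun n => ENNReal.ofReal (dist (TestFn.toBCF (φ n)) v)) atTop (𝓝 0) := by
        rw [← ENNReal.ofReal_zero]
        exact ENNReal.tendsto_ofReal (tendsto_iff_dist_tendsto_zero.1 hv)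
      refine le_antisymm (ge_of_tendsto' (by simpa using hlim.add hd) fun n => ?_) bot_le
      have hs : (fun x => u x - v x) =
          (fun x => φ n x - v x) - fun x => φ n x - u x := by
        funext x; simp
      rw [hs, add_comm]
      have hφm := (TestFn.memLp (φ n) 2)
      exact (eLpNorm_sub_le (hφm.sub hvm).1 (hφm.sub hu).1 (by norm_num)).trans
        (add_le_add_left (eLpNorm_sub_le_dist (TestFn.toBCF (φ n)) v 2) _)
    have h1 := (eLpNorm_eq_zero_iff (hu.sub hvm).1 (by norm_num)).1 h0
    filter_upwards [h1] with x hx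
    exact sub_eq_zero.1 hx

theorem integrable_kernel_mul_bcf {k : ℝ → ℝ} (hk : Integrable k)
    (f : BoundedContinuousFunction ℝ ℝ) (x : ℝ) : Integrable fun t => k t * f (x - t) :=
  hk.mul_bdd (f.continuous.comp (by fun_prop)).aestronglyMeasurable
    (Eventually.of_forall fun t => f.norm_coe_le_norm (x - t))

theorem norm_conv_sub_conv_le {k : ℝ → ℝ} (hk : Integrable k)
    (f g : BoundedContinuousFunction ℝ ℝ) (x : ℝ) :
    ‖(∫ t, k t * f (x - t)) - ∫ t, k t * g (x - t)‖ ≤ (∫ t, ‖k t‖) * dist f g := by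
  rw [← integral_sub (integrable_kernel_mul_bcf hk f x) (integrable_kernel_mul_bcf hk g x),
    ← integral_mul_const]
  refine norm_integral_le_of_norm_le (hk.norm.mul_const _) (Eventually.of_forall fun t => ?_)
  rw [← mul_sub, norm_mul, ← dist_eq_norm (f (x - t))]
  gcongr
  exact BoundedContinuousFunction.dist_coe_le_dist _

theorem continuous_conv_bcf {k : ℝ → ℝ} (hk : Integrable k)
    (f : BoundedContinuousFunction ℝ ℝ) : Continuous fun x => ∫ t, k t * f (x - t) := by
  refine continuous_of_dominated (bound := fun t => ‖k t‖ * ‖f‖) (fun x =>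
    (integrable_kernel_mul_bcf hk f x).1) (fun x => Eventually.of_forall fun t => ?_)
    (hk.norm.mul_const _) (Eventually.of_forall fun t => by fun_prop)
  rw [norm_mul]
  gcongr
  exact f.norm_coe_le_norm _

theorem integrable_conv_mul_deriv {k : ℝ → ℝ} (hk : Integrable k)
    (f : BoundedContinuousFunction ℝ ℝ) (ψ : 𝓓(unitInterval01, ℝ)) :
    Integrable (fun x => (∫ t, k t * f (x - t)) * deriv ψ x) mu01 :=
  (memLp_mu01_of_continuousOn ((continuous_conv_bcf hk f).mul
    (TestFn.continuous_deriv ψ)).continuousOn 1).integrable le_rfl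

theorem tendsto_integral_conv_mul_deriv {k : ℝ → ℝ} (hk : Integrable k)
    {f : ℕ → BoundedContinuousFunction ℝ ℝ} {v : BoundedContinuousFunction ℝ ℝ}
    (hf : Tendsto f atTop (𝓝 v)) (ψ : 𝓓(unitInterval01, ℝ)) :
    Tendsto (fun n => ∫ x, (∫ t, k t * f n (x - t)) * deriv ψ x ∂mu01) atTop
      (𝓝 (∫ x, (∫ t, k t * v (x - t)) * deriv ψ x ∂mu01)) := by
  rw [tendsto_iff_norm_sub_tendsto_zero]
  have hd := tendsto_iff_dist_tendsto_zero.1 hf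
  refine squeeze_zero (fun n => norm_nonneg _) (fun n => ?_)
    (g := fun n => (∫ t, ‖k t‖) * dist (f n) v * ∫ x, ‖deriv ψ x‖ ∂mu01)
    (by simpa using (hd.const_mul (∫ t, ‖k t‖)).mul_const (∫ x, ‖deriv ψ x‖ ∂mu01))
  rw [← integral_sub (integrable_conv_mul_deriv hk _ ψ) (integrable_conv_mul_deriv hk _ ψ),
    ← integral_const_mul]
  refine norm_integral_le_of_norm_le
    (((TestFn.memLp_deriv ψ 1).integrable le_rfl).norm.const_mul _)
    (Eventually.of_forall fun x => ?_)
  rw [← sub_mul, norm_mul]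
  gcongr
  exact norm_conv_sub_conv_le hk _ _ x

/-- The Cauchy condition bounds the Sobolev norms of the tail, so the functionals `ψ ↦ ∫ (k * φ n)
ψ'` are uniformly bounded in `L²`. Uniform convergence carries the bound to `v`, whose own Sobolev
norm is never needed. -/
theorem memH1_conv_of_tendsto {β A : ℝ} (hβ0 : 0 ≤ β) (hβ1 : β ≤ 1) {k : ℝ → ℝ}
    (hk : Integrable k)
    (hkF : ∀ ω : ℝ, ω ≠ 0 → ‖𝓕 (fun t => (k t : ℂ)) ω‖ ≤ A * |ω| ^ (-β))
    {φ : ℕ → 𝓓(unitInterval01, ℝ)}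
    (hφ : ∀ ε : ℝ≥0∞, 0 < ε → ∃ N : ℕ, ∀ m ≥ N, ∀ n ≥ N,
      sobolevNorm (1 - β) (fun x => φ m x - φ n x) < ε)
    {v : BoundedContinuousFunction ℝ ℝ}
    (hv : Tendsto (fun n => TestFn.toBCF (φ n)) atTop (𝓝 v)) :
    MemH1 fun x => ∫ t, k t * v (x - t) := by
  obtain ⟨N, hN⟩ := hφ 1 one_pos
  set B := ENNReal.ofReal (2 * Real.pi * A) with hB
  set S := sobolevNorm (1 - β) (φ N) with hS
  have hStop : S ≠ ⊤ := by
    rw [hS, TestFn.sobolevNorm_eq]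
    exact (schwartzSobolevNorm_lt_top (by linarith) (by linarith) _).ne
  have hD : B * 1 + B * S ≠ ⊤ := by
    rw [mul_one]
    exact ENNReal.add_ne_top.2
      ⟨ENNReal.ofReal_ne_top, ENNReal.mul_ne_top ENNReal.ofReal_ne_top hStop⟩
  refine memH1_of_bound (memLp_mu01_of_continuousOn (continuous_conv_bcf hk v).continuousOn 2)
    (B * 1 + B * S).toReal fun ψ => ?_
  have hψ : eLpNorm ψ 2 mu01 ≠ ⊤ := (TestFn.memLp ψ 2).2.ne
  have key : ‖∫ x, (∫ t, k t * v (x - t)) * deriv ψ x ∂mu01‖ₑ ≤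
      (B * 1 + B * S) * eLpNorm ψ 2 mu01 := by
    refine le_of_tendsto ((continuous_enorm.tendsto _).comp
      (tendsto_integral_conv_mul_deriv hk hv ψ)) (eventually_atTop.2 ⟨N, fun n hn => ?_⟩)
    have h1 := enorm_integral_conv_test_mul_deriv_le hk hkF (φ n - φ N) ψ
    have h2 := enorm_integral_conv_test_mul_deriv_le hk hkF (φ N) ψ
    have h3 : sobolevNorm (1 - β) (φ n - φ N : 𝓓(unitInterval01, ℝ)) ≤ 1 :=
      (hN n hn N le_rfl).le
    have hsplit : ∫ x, (∫ t, k t * TestFn.toBCF (φ n) (x - t)) * deriv ψ x ∂mu01 =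
        (∫ x, (∫ t, k t * (φ n - φ N) (x - t)) * deriv ψ x ∂mu01) +
          ∫ x, (∫ t, k t * φ N (x - t)) * deriv ψ x ∂mu01 := by
      refine Eq.trans ?_ (integral_add (integrable_conv_mul_deriv hk (TestFn.toBCF (φ n - φ N)) ψ)
        (integrable_conv_mul_deriv hk (TestFn.toBCF (φ N)) ψ))
      refine integral_congr_ae (Eventually.of_forall fun x => ?_)
      change _ = _ * deriv ψ x + _ * deriv ψ x
      rw [← add_mul]
      refine congrArg (· * deriv ψ x) (Eq.trans ?_ (integral_add
        (integrable_kernel_mul_bcf hk (TestFn.toBCF (φ n - φ N)) x)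
        (integrable_kernel_mul_bcf hk (TestFn.toBCF (φ N)) x)))
      refine integral_congr_ae (Eventually.of_forall fun t => ?_)
      change k t * φ n (x - t) = k t * (φ n (x - t) - φ N (x - t)) + k t * φ N (x - t)
      ring
    rw [Function.comp_apply, hsplit, add_mul]
    refine (enorm_add_le _ _).trans (add_le_add (h1.trans ?_) h2)
    gcongr
  have h4 := ENNReal.toReal_mono (ENNReal.mul_ne_top hD hψ) key
  rwa [ENNReal.toReal_mul, toReal_enorm, Real.norm_eq_abs] at h4

theorem leftFracInt_congr_ae {σ : ℝ} {u v : ℝ → ℝ} (h : u =ᵐ[mu01] v) {x : ℝ}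
    (hx : x ∈ Icc (0 : ℝ) 1) : leftFracInt 0 σ u x = leftFracInt 0 σ v x := by
  rw [leftFracInt, leftFracInt, intervalIntegral.integral_of_le hx.1,
    intervalIntegral.integral_of_le hx.1, integral_Ioc_eq_integral_Ioo,
    integral_Ioc_eq_integral_Ioo]
  congr 1
  have h' : u =ᵐ[volume.restrict (Ioo 0 x)] v :=
    ae_restrict_of_ae_restrict_of_subset (Ioo_subset_Ioo_right hx.2) h
  exact integral_congr_ae (h'.mono fun s hs => by simp only [hs])

theorem rightFracInt_congr_ae {σ : ℝ} {u v : ℝ → ℝ} (h : u =ᵐ[mu01] v) {x : ℝ}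
    (hx : x ∈ Icc (0 : ℝ) 1) : rightFracInt 1 σ u x = rightFracInt 1 σ v x := by
  rw [rightFracInt, rightFracInt, intervalIntegral.integral_of_le hx.2,
    intervalIntegral.integral_of_le hx.2, integral_Ioc_eq_integral_Ioo,
    integral_Ioc_eq_integral_Ioo]
  congr 1
  have h' : u =ᵐ[volume.restrict (Ioo x 1)] v :=
    ae_restrict_of_ae_restrict_of_subset (Ioo_subset_Ioo_left hx.1) h
  exact integral_congr_ae (h'.mono fun s hs => by simp only [hs])

/-- The two-sided fractional integral maps `H^{1-β}_0(0,1)` into `H¹(0,1) ∩ C[0,1]`. -/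
theorem MemHZero.continuousOn_and_memH1 {β θ : ℝ} (hβ : 0 < β) (hβ2 : β < 1 / 2) {u : ℝ → ℝ}
    (hu : MemHZero (1 - β) u) :
    ContinuousOn (twoSidedFracInt β θ u) (Icc 0 1) ∧ MemH1 (twoSidedFracInt β θ u) := by
  obtain ⟨hu2, φ, hφ, hlim⟩ := hu
  -- Here `β < 1/2` enters as `1 - β > 1/2`, the threshold of the Sobolev embedding.
  obtain ⟨v, hv, hv0, huv⟩ := exists_bcf_limit (by linarith) hu2 hφ hlim
  have hk := integrable_twoSidedKernel hβ θ
  obtain ⟨A, hA⟩ := exists_norm_fourier_twoSidedKernel_le hβ (by linarith) θ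
  have heq : EqOn (twoSidedFracInt β θ u) (fun x => ∫ t, twoSidedKernel β θ t * v (x - t))
      (Icc 0 1) := fun x hx => by
    simp only
    rw [twoSidedFracInt, leftFracInt_congr_ae huv hx, rightFracInt_congr_ae huv hx,
      ← twoSidedFracInt_eq_integral_twoSidedKernel hβ θ hv0 v.continuous v.norm_coe_le_norm hx,
      twoSidedFracInt]
  refine ⟨(continuous_conv_bcf hk v).continuousOn.congr heq, ?_⟩
  obtain ⟨g, hg⟩ := memH1_conv_of_tendsto hβ.le (by linarith) hk hA hφ hv
  exact ⟨g, hg.congr fun x hx => (heq (Ioo_subset_Icc_self hx)).symm⟩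

end FracDiff

open FracDiff in
theorem theorem6p1 (β θ : ℝ) (hβ_pos : 0 < β) (hβ_lt : β < 1 / 2) (hθ_nonneg : 0 ≤ θ)
    (hθ_le : θ ≤ 1) (K : ℝ → ℝ) (Km KM : ℝ) (hKm : 0 < Km)
    (hK_meas : AEStronglyMeasurable K FracDiff.mu01)
    (hK_bounds : ∀ᵐ x ∂FracDiff.mu01, Km ≤ K x ∧ K x ≤ KM)
    (f : FracDiff.HMinus1) (wl wr wf : ℝ → ℝ)
    (hwl : FracDiff.IsDiffusionSolution K 0 1 0 wl)
    (hwr : FracDiff.IsDiffusionSolution K 0 0 1 wr)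
    (hwf : FracDiff.IsDiffusionSolution K f 0 0 wf)
    (u : ℝ → ℝ) :
    (FracDiff.MemHZero (1 - β) u → FracDiff.MemH1 (FracDiff.twoSidedFracInt β θ u)) ∧
    (FracDiff.IsPetrovGalerkinSolution β θ K f u ↔
      FracDiff.MemHZero (1 - β) u ∧
      ∀ x ∈ Set.Icc (0 : ℝ) 1,
        FracDiff.twoSidedFracInt β θ u x
          - (1 - θ) * FracDiff.rightFracInt 1 β u 0 * wl x
          - θ * FracDiff.leftFracInt 0 β u 1 * wr x = wf x) := by
  obtain ⟨hcl, hl0, hl1, gl, hgl, hvl⟩ := hwl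
  obtain ⟨hcr, hr0, hr1, gr, hgr, hvr⟩ := hwr
  obtain ⟨hcf, hf0, hf1, gf, hgf, hvf⟩ := hwf
  have hi := fun {g : ℝ → ℝ} (hg : MemLp g 2 mu01) (v : H10) =>
    integrable_coeff_mul hKm hK_meas hK_bounds hg v
  refine ⟨fun hu => (hu.continuousOn_and_memH1 hβ_pos hβ_lt).2, ⟨?_, ?_⟩⟩
  · rintro ⟨hu, g, hg, hvg⟩
    refine ⟨hu, fun x hx => ?_⟩
    obtain ⟨hc, -⟩ := hu.continuousOn_and_memH1 (θ := θ) hβ_pos hβ_lt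
    set R := (1 - θ) * rightFracInt 1 β u 0 with hR
    set L := θ * leftFracInt 0 β u 1 with hL
    -- At each endpoint one of the two integrals runs over a degenerate interval, leaving the
    -- coefficient in the equation.
    have h0 : twoSidedFracInt β θ u 0 = R := by simp [twoSidedFracInt, leftFracInt, hR]
    have h1 : twoSidedFracInt β θ u 1 = L := by simp [twoSidedFracInt, rightFracInt, hL]
    have hz := eq_zero_of_homogeneous_diffusion hKm hK_meas hK_bounds
      (z := fun x => twoSidedFracInt β θ u x + (-R) * wl x + (-L) * wr x + (-1) * wf x)
      (h := fun x => g x + (-R) * gl x + (-L) * gr x + (-1) * gf x)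
      (((hc.add (continuousOn_const.mul hcl)).add (continuousOn_const.mul hcr)).add
        (continuousOn_const.mul hcf))
      (by simp [h0, hl0, hr0, hf0]) (by simp [h1, hl1, hr1, hf1])
      (((hg.add (hgl.const_mul _)).add (hgr.const_mul _)).add (hgf.const_mul _))
      (fun v => by
        have hexp : ∀ x, K x * (g x + (-R) * gl x + (-L) * gr x + (-1) * gf x) * H10.D v x =
            K x * g x * H10.D v x + (-R) * (K x * gl x * H10.D v x) +
              (-L) * (K x * gr x * H10.D v x) + (-1) * (K x * gf x * H10.D v x) :=
          fun x => by ring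
        simp_rw [hexp]
        have i0 := hi hg.memLp_deriv v
        have i1 := (hi hgl.memLp_deriv v).const_mul (-R)
        have i2 := (hi hgr.memLp_deriv v).const_mul (-L)
        have i3 := (hi hgf.memLp_deriv v).const_mul (-1)
        rw [integral_add ((i0.fun_add i1).fun_add i2) i3, integral_add (i0.fun_add i1) i2,
          integral_add i0 i1, integral_const_mul, integral_const_mul, integral_const_mul,
          hvg, hvl, hvr, hvf]
        simp)
      x hx
    linarith
  · rintro ⟨hu, heq⟩
    refine ⟨hu, ?_⟩
    set R := (1 - θ) * rightFracInt 1 β u 0 with hR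
    set L := θ * leftFracInt 0 β u 1 with hL
    -- The integral equation dictates this derivative; `gl` and `gr` have zero right-hand side, so
    -- only `f` survives testing.
    refine ⟨fun x => gf x + R * gl x + L * gr x,
      ((hgf.add (hgl.const_mul R)).add (hgr.const_mul L)).congr fun x hx => ?_, fun v => ?_⟩
    · have := heq x (Ioo_subset_Icc_self hx)
      linarith
    · have hexp : ∀ x, K x * (gf x + R * gl x + L * gr x) * H10.D v x =
          K x * gf x * H10.D v x + R * (K x * gl x * H10.D v x) +
            L * (K x * gr x * H10.D v x) := fun x => by ring
      simp_rw [hexp]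
      have i0 := hi hgf.memLp_deriv v
      have i1 := (hi hgl.memLp_deriv v).const_mul R
      have i2 := (hi hgr.memLp_deriv v).const_mul L
      rw [integral_add (i0.fun_add i1) i2, integral_add i0 i1, integral_const_mul,
        integral_const_mul, hvl, hvr, hvf]
      simp
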